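/- Let $\mathcal L_0\subseteq\mathcal L$ be first-order languages, possibly many-sorted (with the same set of sorts); all theories are closed under deduction, and structures (or single sorts) are allowed to be empty. For a theory $T$, let $T^\forall$ be its set of universal consequences; write $A\leq_{\mathcal L}B$ for "$A$ is an $\mathcal L$-substructure of $B$" and $\langle A\rangle_{\mathcal L}$ for the $\mathcal L$-substructure generated by $A$. A monster model is a $\kappa$-saturated and strongly $\kappa$-homogeneous model, and a subset of it is small if its cardinality is less than $\kappa$; here $\kappa$ is larger than $|\mathcal L|+\aleph_0$ (with sorts counted in $|\mathcal L|$), for both monster models below, and may be different for each of them. Let $T_0$ be a complete and model complete $\mathcal L_0$-theory, $\mathcal U_0$ a monster model of $T_0$, and $\perp^0$ an automorphism-invariant ternary relation on small subsets of $\mathcal U_0$, written $A\perp^0_C B$. Let $T$ be an $\mathcal L$-theory with $T_0^\forall\subseteq T$. Let $\operatorname{acl}_0,\operatorname{dcl}_0$ be the model-theoretic algebraic and definable closure in the $\mathcal L_0$-structure $\mathcal U_0$. Assume that $T$ is derivation-like with respect to $(T_0,\perp^0)$, that is: whenever $A,B,C\models T^\forall$ are small with $A,B\leq_{\mathcal L_0}\mathcal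 U_0$, $C$ a common $\mathcal L$-substructure of $A$ and $B$, $\operatorname{acl}_0(C)\cap A=\operatorname{acl}_0(C)\cap B=C$ and $A\perp^0_C B$, then (i) there is $M\models T$ with $M\leq_{\mathcal L_0}\mathcal U_0$ and $A,B\leq_{\mathcal L}M$; and (ii) for every $M$ as in (i) and every $\mathcal L_0$-structure $D$ with $\langle A,B\rangle_{\mathcal L_0}\leq_{\mathcal L_0}D\leq_{\mathcal L_0}\operatorname{acl}_0(A,B)\cap M$ we have $D\leq_{\mathcal L}M$, and this $\mathcal L$-structure on $D$ is the unique one that expands its $\mathcal L_0$-structure, is a model of $T^\forall$, and extends the $\mathcal L$-structures of $A$ and $B$. Assume further that $T$ has a model companion $T_+\supseteq T$ and that, if $T_0\not\subseteq T_+$, then $T_0$ has quantifier elimination. Let $\mathcal U_+$ be a monster model of a completion of $T_+$ with $\mathcal U_+\leq_{\mathcal L_0}\mathcal U_0$, and let $\operatorname{acl}_+,\operatorname{dcl}_+$ be the algebraic and definable closure in the $\mathcal L$-structure $\mathcal U_+$. Suppose that $\perp^0$ satisfies, for all small sets: - monotonicity: $A\perp^0_C B\cup D$ implies $A\perp^0_C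 B$; - symmetry: $A\perp^0_C B$ implies $B\perp^0_C A$; - full existence: for all $A,B,C$ there is $A'$ with $\operatorname{tp}_0(A'/C)=\operatorname{tp}_0(A/C)$ and $A'\perp^0_C B$; - anti-reflexivity: for every element $a$ of $\mathcal U_0$, $a\perp^0_C a$ implies $a\in\operatorname{acl}_0(C)$. Then for every $A\subseteq\mathcal U_+$, $$\operatorname{acl}_+(A)=\operatorname{acl}_0(\langle A\rangle_{\mathcal L})\cap\mathcal U_+ .$$ If in addition $T_0\subseteq T_+$, then for every $A\subseteq\mathcal U_+$, $$\operatorname{dcl}_+(A)=\operatorname{dcl}_0(\langle A\rangle_{\mathcal L}).$$ -/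

import Mathlib

universe u

open Cardinal

/-- A many-sorted first-order language with set of sorts `S`: `Fn σ s` are the function symbols
with list of argument sorts `σ` and value sort `s` (constants have `σ = []`), and `Rel σ` are the
relation symbols with list of argument sorts `σ`. The one-sorted case is `S = PUnit`. -/
structure MSLang (S : Type u) where
  Fn : List S → S → Type u
  Rel : List S → Type u

/-- A set of elements of the `S`-sorted universe `M`, given sort by sort. -/
abbrev SortedSet {S : Type u} (M : S → Type u) : Type u := ∀ s, Set (M s)

namespace SortedSet

variable {S : Type u} {M N : S → Type u}

/-- The image under a sort-preserving map. -/
def image (f : ∀ s, M s → N s) (A : SortedSet M) : SortedSet N := fun s => f s '' A s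

/-- The set whose only element is `a`, an element of sort `s`. -/
def single {s : S} (a : M s) : SortedSet M := fun t => {b | (⟨t, b⟩ : Σ r, M r) = ⟨s, a⟩}

/-- The total number of elements, in all sorts. -/
noncomputable def card (A : SortedSet M) : Cardinal.{u} := #(Σ s, A s)

end SortedSet

namespace MSLang

variable {S : Type u}

/-- The cardinality of a language (sorts and symbols, at least `ℵ₀`). -/
noncomputable def card (L : MSLang S) : Cardinal.{u} :=
  max ℵ₀ (#S + #(Σ σ, Σ s, L.Fn σ s) + #(Σ σ, L.Rel σ))

/-! ### Terms, formulas, structures, satisfaction -/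

/-- Tuples of elements of `M` with sorts listed by `Γ`. -/
abbrev Tup (M : S → Type u) (Γ : List S) : Type u := ∀ i : Fin Γ.length, M (Γ.get i)

/-- The tuple `(a, v)`. -/
def consTup {M : S → Type u} {s : S} {Γ : List S} (a : M s) (v : Tup M Γ) : Tup M (s :: Γ) :=
  Fin.cons (α := fun i : Fin (Γ.length + 1) => M ((s :: Γ).get i)) a v

/-- Terms whose variables are the positions of the list of sorts `Γ`. -/
inductive Term (L : MSLang S) (Γ : List S) : S → Type u
  | var (i : Fin Γ.length) : Term L Γ (Γ.get i)
  | app {σ : List S} {s : S} (f : L.Fn σ s)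
      (ts : ∀ i : Fin σ.length, Term L Γ (σ.get i)) : Term L Γ s

/-- First-order formulas whose free variables are the positions of the list of sorts `Γ`.
Quantifiers bind the head of the list. The other connectives and `∃` are the usual (classical)
abbreviations. -/
inductive Formula (L : MSLang S) : List S → Type u
  | falsum {Γ : List S} : Formula L Γ
  | eq {Γ : List S} {s : S} (t₁ t₂ : L.Term Γ s) : Formula L Γ
  | rel {Γ σ : List S} (R : L.Rel σ) (ts : ∀ i : Fin σ.length, L.Term Γ (σ.get i)) : Formula L Γ
  | imp {Γ : List S} (φ ψ : Formula L Γ) : Formula L Γ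
  | all {Γ : List S} (s : S) (φ : Formula L (s :: Γ)) : Formula L Γ

/-- Sentences are formulas without free variables. -/
abbrev Sentence (L : MSLang S) : Type u := L.Formula []

/-- A theory is a set of sentences. -/
abbrev Theory (L : MSLang S) : Type u := Set L.Sentence

/-- An `L`-structure on the sorted universe `M`. Sorts may be empty. -/
structure Str (L : MSLang S) (M : S → Type u) where
  fn : ∀ {σ : List S} {s : S}, L.Fn σ s → Tup M σ → M s
  rel : ∀ {σ : List S}, L.Rel σ → Tup M σ → Prop

section Semantics

variable {L : MSLang S} {M N : S → Type u}

/-- The value of a term at a tuple. -/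
def Term.val (𝓜 : L.Str M) {Γ : List S} (v : Tup M Γ) : ∀ {s : S}, L.Term Γ s → M s
  | _, .var i => v i
  | _, .app f ts => 𝓜.fn f fun i => (ts i).val 𝓜 v

/-- Tarski's satisfaction relation `𝓜 ⊨ φ(v)`. -/
def Str.Sat (𝓜 : L.Str M) : ∀ {Γ : List S}, L.Formula Γ → Tup M Γ → Prop
  | _, .falsum, _ => False
  | _, .eq t₁ t₂, v => t₁.val 𝓜 v = t₂.val 𝓜 v
  | _, .rel R ts, v => 𝓜.rel R fun i => (ts i).val 𝓜 v
  | _, .imp φ ψ, v => 𝓜.Sat φ v → 𝓜.Sat ψ v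
  | _, .all s φ, v => ∀ a : M s, 𝓜.Sat φ (consTup a v)

/-- `𝓜 ⊨ φ` for a sentence `φ`. -/
def Str.Holds (𝓜 : L.Str M) (φ : L.Sentence) : Prop := 𝓜.Sat φ fun i => i.elim0

/-- `𝓜 ⊨ T`. -/
def Str.Models (𝓜 : L.Str M) (T : L.Theory) : Prop := ∀ φ ∈ T, 𝓜.Holds φ

/-- `f` is an embedding of `L`-structures. -/
structure IsEmb (𝓜 : L.Str M) (𝓝 : L.Str N) (f : ∀ s, M s → N s) : Prop where
  injective : ∀ s, Function.Injective (f s)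
  map_fn : ∀ {σ : List S} {s : S} (F : L.Fn σ s) (v : Tup M σ),
    f s (𝓜.fn F v) = 𝓝.fn F fun i => f _ (v i)
  map_rel : ∀ {σ : List S} (R : L.Rel σ) (v : Tup M σ),
    𝓜.rel R v ↔ 𝓝.rel R fun i => f _ (v i)

/-- `f` is an automorphism of `𝓜`. -/
def IsAut (𝓜 : L.Str M) (f : ∀ s, M s → M s) : Prop :=
  IsEmb 𝓜 𝓜 f ∧ ∀ s, Function.Surjective (f s)

/-- The restriction of `f` to the set `D` is a partial elementary map from `𝓜` to `𝓝`. -/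
def ElemOn (𝓜 : L.Str M) (𝓝 : L.Str N) (D : SortedSet M) (f : ∀ s, M s → N s) : Prop :=
  ∀ {Γ : List S} (φ : L.Formula Γ) (v : Tup M Γ), (∀ i, v i ∈ D (Γ.get i)) →
    (𝓜.Sat φ v ↔ 𝓝.Sat φ fun i => f _ (v i))

/-- `A ≡_C A'` in `𝓜`: some enumeration of `A'` has the same type over `C` as the corresponding
enumeration of `A`. -/
def EquivOver (𝓜 : L.Str M) (C A A' : SortedSet M) : Prop :=
  ∃ h : ∀ s, M s → M s, ElemOn 𝓜 𝓜 (A ⊔ C) h ∧ (∀ s, ∀ c ∈ C s, h s c = c) ∧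
    A' = SortedSet.image h A

/-- The set `B` is closed under the functions of `𝓜` (it is the universe of a substructure). -/
def Str.Closed (𝓜 : L.Str M) (B : SortedSet M) : Prop :=
  ∀ {σ : List S} {s : S} (f : L.Fn σ s) (v : Tup M σ), (∀ i, v i ∈ B (σ.get i)) → 𝓜.fn f v ∈ B s

/-- The (universe of the) substructure `⟨A⟩_L` of `𝓜` generated by `A`. -/
def Str.gen (𝓜 : L.Str M) (A : SortedSet M) : SortedSet M :=
  fun s => {a | ∀ B : SortedSet M, 𝓜.Closed B → A ≤ B → a ∈ B s}

/-- Model-theoretic algebraic closure: the elements lying in a finite set definable over `A`. -/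
def Str.acl (𝓜 : L.Str M) (A : SortedSet M) : SortedSet M :=
  fun s => {a | ∃ (Γ : List S) (φ : L.Formula (s :: Γ)) (p : Tup M Γ),
    (∀ i, p i ∈ A (Γ.get i)) ∧ 𝓜.Sat φ (consTup a p) ∧
    {b : M s | 𝓜.Sat φ (consTup b p)}.Finite}

/-- Model-theoretic definable closure: the elements `a` with `{a}` definable over `A`. -/
def Str.dcl (𝓜 : L.Str M) (A : SortedSet M) : SortedSet M :=
  fun s => {a | ∃ (Γ : List S) (φ : L.Formula (s :: Γ)) (p : Tup M Γ),
    (∀ i, p i ∈ A (Γ.get i)) ∧ 𝓜.Sat φ (consTup a p) ∧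
    ∀ b : M s, 𝓜.Sat φ (consTup b p) → b = a}

/-- `κ`-saturation: every set of formulas in one variable, with parameters in a set of size
less than `κ`, that is finitely satisfiable in `𝓜` is realised in `𝓜`. -/
def Str.Saturated (𝓜 : L.Str M) (κ : Cardinal.{u}) : Prop :=
  ∀ D : SortedSet M, D.card < κ → ∀ (s : S) (p : Set (Σ Γ : List S, L.Formula (s :: Γ) × Tup M Γ)),
    (∀ x ∈ p, ∀ i, x.2.2 i ∈ D (x.1.get i)) →
    (∀ q : Finset (Σ Γ : List S, L.Formula (s :: Γ) × Tup M Γ), (q : Set _) ⊆ p →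
      ∃ a : M s, ∀ x ∈ q, 𝓜.Sat x.2.1 (consTup a x.2.2)) →
    ∃ a : M s, ∀ x ∈ p, 𝓜.Sat x.2.1 (consTup a x.2.2)

/-- Strong `κ`-homogeneity: partial elementary maps between sets of size less than `κ` extend to
automorphisms. -/
def Str.StronglyHomogeneous (𝓜 : L.Str M) (κ : Cardinal.{u}) : Prop :=
  ∀ (D : SortedSet M) (h : ∀ s, M s → M s), D.card < κ → ElemOn 𝓜 𝓜 D h →
    ∃ g : ∀ s, M s → M s, IsAut 𝓜 g ∧ ∀ s, ∀ a ∈ D s, g s a = h s a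

end Semantics

/-! ### Theories -/

section Theories

variable {L : MSLang S}

/-- `φ` is a (semantic) consequence of `T`. -/
def Theory.Entails (T : L.Theory) (φ : L.Sentence) : Prop :=
  ∀ (M : S → Type u) (𝓜 : L.Str M), 𝓜.Models T → 𝓜.Holds φ

/-- `T` is closed under deductions. -/
def Theory.DeductivelyClosed (T : L.Theory) : Prop := ∀ φ, T.Entails φ → φ ∈ T

/-- `T` is complete: it has a model, and it decides every sentence. -/
def Theory.Complete (T : L.Theory) : Prop :=
  (∃ (M : S → Type u) (𝓜 : L.Str M), 𝓜.Models T) ∧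
    ∀ φ : L.Sentence, T.Entails φ ∨ T.Entails (.imp φ .falsum)

/-- `T` is model complete: all embeddings between its models are elementary. -/
def Theory.ModelComplete (T : L.Theory) : Prop :=
  ∀ (M N : S → Type u) (𝓜 : L.Str M) (𝓝 : L.Str N), 𝓜.Models T → 𝓝.Models T →
    ∀ f : ∀ s, M s → N s, IsEmb 𝓜 𝓝 f → ElemOn 𝓜 𝓝 ⊤ f

/-- Quantifier-free formulas. -/
inductive Formula.IsQF : ∀ {Γ : List S}, L.Formula Γ → Prop
  | falsum {Γ : List S} : IsQF (.falsum : L.Formula Γ)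
  | eq {Γ : List S} {s : S} (t₁ t₂ : L.Term Γ s) : IsQF (.eq t₁ t₂)
  | rel {Γ σ : List S} (R : L.Rel σ) (ts : ∀ i : Fin σ.length, L.Term Γ (σ.get i)) :
      IsQF (.rel R ts)
  | imp {Γ : List S} {φ ψ : L.Formula Γ} : IsQF φ → IsQF ψ → IsQF (.imp φ ψ)

/-- Universal formulas `∀ x₁ … xₙ, ψ` with `ψ` quantifier-free. -/
inductive Formula.IsUniversal : ∀ {Γ : List S}, L.Formula Γ → Prop
  | of_qf {Γ : List S} {φ : L.Formula Γ} : φ.IsQF → IsUniversal φ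
  | all {Γ : List S} {s : S} {φ : L.Formula (s :: Γ)} : IsUniversal φ → IsUniversal (.all s φ)

/-- `T^∀`, the set of universal consequences of `T`. -/
def Theory.univPart (T : L.Theory) : L.Theory := {φ | φ.IsUniversal ∧ T.Entails φ}

/-- `T` has quantifier elimination. -/
def Theory.QE (T : L.Theory) : Prop :=
  ∀ (Γ : List S) (φ : L.Formula Γ), ∃ ψ : L.Formula Γ, ψ.IsQF ∧
    ∀ (M : S → Type u) (𝓜 : L.Str M), 𝓜.Models T → ∀ v : Tup M Γ, 𝓜.Sat φ v ↔ 𝓜.Sat ψ v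

/-- `T'` is a model companion of `T`: `T'` is model complete, and every model of either theory
embeds in a model of the other. -/
structure Theory.IsModelCompanion (T' T : L.Theory) : Prop where
  modelComplete : T'.ModelComplete
  extend : ∀ (M : S → Type u) (𝓜 : L.Str M), 𝓜.Models T →
    ∃ (N : S → Type u) (𝓝 : L.Str N) (f : ∀ s, M s → N s), 𝓝.Models T' ∧ IsEmb 𝓜 𝓝 f
  extend' : ∀ (M : S → Type u) (𝓜 : L.Str M), 𝓜.Models T' →
    ∃ (N : S → Type u) (𝓝 : L.Str N) (f : ∀ s, M s → N s), 𝓝.Models T ∧ IsEmb 𝓜 𝓝 f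

/-- `𝓤` is a monster model of `T`, with `small` meaning `of cardinality less than κ`. -/
structure IsMonster (T : L.Theory) {U : S → Type u} (𝓤 : L.Str U) (κ : Cardinal.{u}) : Prop where
  models : 𝓤.Models T
  card_lt : L.card < κ
  saturated : 𝓤.Saturated κ
  homogeneous : 𝓤.StronglyHomogeneous κ

end Theories

/-! ### Two languages -/

/-- `L₀ ⊆ L` (with the same sorts). -/
structure Incl (L₀ L : MSLang S) where
  fn : ∀ {σ : List S} {s : S}, L₀.Fn σ s → L.Fn σ s
  rel : ∀ {σ : List S}, L₀.Rel σ → L.Rel σ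
  fn_injective : ∀ (σ : List S) (s : S), Function.Injective (fn : L₀.Fn σ s → L.Fn σ s)
  rel_injective : ∀ σ : List S, Function.Injective (rel : L₀.Rel σ → L.Rel σ)

section TwoLanguages

variable {L₀ L : MSLang S}

/-- An `L₀`-term, read as an `L`-term. -/
def Incl.term (ι : L₀.Incl L) {Γ : List S} : ∀ {s : S}, L₀.Term Γ s → L.Term Γ s
  | _, .var i => .var i
  | _, .app f ts => .app (ι.fn f) fun i => ι.term (ts i)

/-- An `L₀`-formula, read as an `L`-formula. -/
def Incl.formula (ι : L₀.Incl L) : ∀ {Γ : List S}, L₀.Formula Γ → L.Formula Γ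
  | _, .falsum => .falsum
  | _, .eq t₁ t₂ => .eq (ι.term t₁) (ι.term t₂)
  | _, .rel R ts => .rel (ι.rel R) fun i => ι.term (ts i)
  | _, .imp φ ψ => .imp (ι.formula φ) (ι.formula ψ)
  | _, .all s φ => .all s (ι.formula φ)

/-- An `L₀`-theory, read as a set of `L`-sentences. -/
def Incl.theory (ι : L₀.Incl L) (T₀ : L₀.Theory) : L.Theory := {ψ | ∃ φ ∈ T₀, ι.formula φ = ψ}

/-- The `L₀`-reduct of an `L`-structure. -/
def Str.reduct {M : S → Type u} (𝓜 : L.Str M) (ι : L₀.Incl L) : L₀.Str M where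
  fn f v := 𝓜.fn (ι.fn f) v
  rel R v := 𝓜.rel (ι.rel R) v

variable {U : S → Type u}

/-- An `L`-structure `A` with `A ≤_{L₀} 𝓤`: its universe is a subset of that of `𝓤`, and its
`L₀`-reduct is a substructure of `𝓤`. -/
@[ext]
structure Over (ι : L₀.Incl L) (𝓤 : L₀.Str U) where
  carrier : SortedSet U
  str : L.Str (fun s => carrier s)
  isEmb : IsEmb (str.reduct ι) 𝓤 (fun _ => Subtype.val)

/-- `A ≤_L B`: `A` is an `L`-substructure of `B`. -/
def Over.IsSub {ι : L₀.Incl L} {𝓤 : L₀.Str U} (A B : Over ι 𝓤) : Prop :=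
  ∃ h : ∀ s, A.carrier s ⊆ B.carrier s, IsEmb A.str B.str (fun s => Set.inclusion (h s))

/-- The universe of the `L`-structure `A`, as a sorted type. -/
abbrev Over.Univ {ι : L₀.Incl L} {𝓤 : L₀.Str U} (A : Over ι 𝓤) : S → Type u := fun s => A.carrier s

/-- A set of elements of `A ≤_{L₀} 𝓤`, viewed as a set of elements of `𝓤`. -/
def Over.push {ι : L₀.Incl L} {𝓤 : L₀.Str U} (A : Over ι 𝓤) (X : SortedSet A.Univ) : SortedSet U :=
  SortedSet.image (fun _ => Subtype.val) X

end TwoLanguages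

/-! ### Ternary relations on small subsets

`ind A C B` stands for `A ⫝_C B`. Only its restriction to small sets (of cardinality less
than `κ`) is ever used. -/

section Independence

variable {L₀ L : MSLang S} {U : S → Type u}

/-- Invariance under automorphisms. -/
def IndInvariant (𝓤 : L₀.Str U) (κ : Cardinal.{u}) (ind : SortedSet U → SortedSet U → SortedSet U → Prop) :
    Prop :=
  ∀ f : ∀ s, U s → U s, IsAut 𝓤 f → ∀ A C B : SortedSet U, A.card < κ → C.card < κ → B.card < κ →
    (ind A C B ↔ ind (A.image f) (C.image f) (B.image f))

/-- Monotonicity. -/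
def IndMonotone (κ : Cardinal.{u}) (ind : SortedSet U → SortedSet U → SortedSet U → Prop) : Prop :=
  ∀ A C B D : SortedSet U, A.card < κ → C.card < κ → B.card < κ → D.card < κ →
    ind A C (B ⊔ D) → ind A C B

/-- Symmetry. -/
def IndSymmetric (κ : Cardinal.{u}) (ind : SortedSet U → SortedSet U → SortedSet U → Prop) : Prop :=
  ∀ A C B : SortedSet U, A.card < κ → C.card < κ → B.card < κ → ind A C B → ind B C A

/-- Full existence. -/
def IndFullExistence (𝓤 : L₀.Str U) (κ : Cardinal.{u})
    (ind : SortedSet U → SortedSet U → SortedSet U → Prop) : Prop :=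
  ∀ A B C : SortedSet U, A.card < κ → B.card < κ → C.card < κ →
    ∃ A' : SortedSet U, EquivOver 𝓤 C A A' ∧ ind A' C B

/-- Anti-reflexivity. -/
def IndAntiReflexive (𝓤 : L₀.Str U) (κ : Cardinal.{u})
    (ind : SortedSet U → SortedSet U → SortedSet U → Prop) : Prop :=
  ∀ (C : SortedSet U) (s : S) (a : U s), C.card < κ →
    ind (SortedSet.single a) C (SortedSet.single a) → a ∈ 𝓤.acl C s

/-- `T` is derivation-like with respect to `(T₀, ind)`, where `𝓤` is the monster model of `T₀` and
`small` means `of cardinality less than κ`. -/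
def DerivationLike (ι : L₀.Incl L) (T : L.Theory) (𝓤 : L₀.Str U) (κ : Cardinal.{u})
    (ind : SortedSet U → SortedSet U → SortedSet U → Prop) : Prop :=
  ∀ A B C : Over ι 𝓤,
    A.carrier.card < κ → B.carrier.card < κ → C.carrier.card < κ →
    A.str.Models T.univPart → B.str.Models T.univPart → C.str.Models T.univPart →
    C.IsSub A → C.IsSub B →
    𝓤.acl C.carrier ⊓ A.carrier = C.carrier → 𝓤.acl C.carrier ⊓ B.carrier = C.carrier →
    ind A.carrier C.carrier B.carrier →
    (∃ M : Over ι 𝓤, M.str.Models T ∧ A.IsSub M ∧ B.IsSub M) ∧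
    ∀ M : Over ι 𝓤, M.str.Models T → A.IsSub M → B.IsSub M →
      ∀ D : SortedSet U, 𝓤.Closed D →
        𝓤.gen (A.carrier ⊔ B.carrier) ≤ D →
        D ≤ 𝓤.acl (A.carrier ⊔ B.carrier) ⊓ M.carrier →
        ∃ E : Over ι 𝓤, E.carrier = D ∧ E.IsSub M ∧
          ∀ E' : Over ι 𝓤, E'.carrier = D → E'.str.Models T.univPart →
            A.IsSub E' → B.IsSub E' → E' = E

end Independence

end MSLang

/-! Write `E` for the `L`-substructure generated by `A` and `C` for `acl₀(E) ∩ U₊`. Closures have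
finite character, so `A` may be taken to be the set of parameters of one formula. By
Löwenheim-Skolem it then lies in an elementary `L`-substructure `B` of `U₊` of size at most `|L|`,
which is small in `U₀`.

The inclusion of `C` in `acl₊(A)` holds because the trace on `U₊` of an `L₀`-definable set is
`L`-definable: either `T₀ ⊆ T₊` and model completeness makes `U₊` an elementary `L₀`-substructure of
`U₀`, or `T₀` eliminates quantifiers.

The converse is an amalgamation argument. Clause (ii) of derivation-likeness makes `C` an
`L`-substructure (`DerivationLike.exists_relative_acl`). Full existence gives a conjugate of `B`
over `C` that is independent from `B`. Clause (i) puts both in a model of `T`, hence in a model `N`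
of `T₊`, and both embeddings are elementary by model completeness. By monotonicity, symmetry and
anti-reflexivity the two copies meet only inside `acl₀(C)` (`DerivationLike.exists_amalgam`). A
finite set definable over `A` has the same image in `N` from both copies, so its elements lie in
that intersection.

For `dcl`, suppose `b ∈ dcl₊(A)` is not in `dcl₀(E)`. Since `b ∈ acl₀(E)`, some automorphism `g` of
`U₀` fixes `E` pointwise and moves `b`. When `T₀ ⊆ T₊`, `C` is all of `acl₀(E)`, which `g` preserves
as a set; uniqueness in clause (ii) makes `g` an `L`-automorphism of `C`. So `B` and `g(B)` can be
amalgamated over `C`, and then `b` and `g(b)` become two distinct solutions in `N` of the formula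
defining `b`. The other inclusion is elementarity of `U₊` in `U₀`. -/

namespace MSLang

variable {S : Type u}

/-! ### Substitution and bounds on the number of solutions. -/

section Substitution

variable {L : MSLang S}

/-- Simultaneous substitution of terms for variables in a term. -/
def Term.subst {Γ Δ : List S} (r : ∀ i : Fin Γ.length, L.Term Δ (Γ.get i)) :
    ∀ {s : S}, L.Term Γ s → L.Term Δ s
  | _, .var i => r i
  | _, .app f ts => .app f fun i => (ts i).subst r

/-- Weakening of a term by one new variable. -/
def Term.weak (s : S) {Γ : List S} {t : S} (τ : L.Term Γ t) : L.Term (s :: Γ) t :=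
  τ.subst fun i => .var (Γ := s :: Γ) i.succ

/-- Extension of a family of terms by a term for a new variable. -/
def consTerm {Δ Γ : List S} {s : S} (τ : L.Term Δ s) (r : ∀ i : Fin Γ.length, L.Term Δ (Γ.get i)) :
    ∀ i : Fin (s :: Γ).length, L.Term Δ ((s :: Γ).get i) :=
  Fin.cons (α := fun i : Fin (Γ.length + 1) => L.Term Δ ((s :: Γ).get i)) τ r

/-- The variable at the head of the context. -/
def headVar (L : MSLang S) (s : S) (Γ : List S) : L.Term (s :: Γ) s :=
  .var (Γ := s :: Γ) 0

/-- A substitution, carried below a quantifier. -/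
def liftSubst (s : S) {Δ Γ : List S} (r : ∀ i : Fin Γ.length, L.Term Δ (Γ.get i)) :
    ∀ i : Fin (s :: Γ).length, L.Term (s :: Δ) ((s :: Γ).get i) :=
  consTerm (headVar L s Δ) fun i => (r i).weak s

/-- Simultaneous substitution of terms for free variables in a formula. -/
def Formula.subst : ∀ {Γ Δ : List S}, (∀ i : Fin Γ.length, L.Term Δ (Γ.get i)) →
    L.Formula Γ → L.Formula Δ
  | _, _, _, .falsum => .falsum
  | _, _, r, .eq t₁ t₂ => .eq (t₁.subst r) (t₂.subst r)
  | _, _, r, .rel R ts => .rel R fun i => (ts i).subst r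
  | _, _, r, .imp φ ψ => .imp (φ.subst r) (ψ.subst r)
  | _, _, r, .all s φ => .all s (φ.subst (liftSubst s r))

/-- Negation. -/
def Formula.not {Γ : List S} (φ : L.Formula Γ) : L.Formula Γ := .imp φ .falsum

/-- Conjunction. -/
def Formula.and {Γ : List S} (φ ψ : L.Formula Γ) : L.Formula Γ := (φ.imp ψ.not).not

/-- Existential quantification. -/
def Formula.ex {Γ : List S} (s : S) (φ : L.Formula (s :: Γ)) : L.Formula Γ := (Formula.all s φ.not).not

/-- The formula `φ(x, v) ∧ x ≠ z` with free variables `x, z, v`. -/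
def Formula.avoid {s : S} {Γ : List S} (φ : L.Formula (s :: Γ)) : L.Formula (s :: s :: Γ) :=
  (φ.subst (liftSubst s fun i => .var (Γ := s :: Γ) i.succ)).and
    (Formula.eq (headVar L s (s :: Γ)) ((headVar L s Γ).weak s)).not

/-- A formula in `v` saying that `φ(x, v)` has at most `k` solutions `x`. -/
def Formula.atMost {s : S} : ∀ (_ : ℕ) {Γ : List S}, L.Formula (s :: Γ) → L.Formula Γ
  | 0, _, φ => .all s φ.not
  | k + 1, _, φ => .ex s (Formula.atMost k φ.avoid)

end Substitution

/-! ### Semantics of substitution; finite definable sets under elementary maps. -/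

section Semantics

variable {L : MSLang S} {M N : S → Type u}

theorem eq_consTup {s : S} {Γ : List S} (v : Tup M (s :: Γ)) :
    v = consTup (s := s) (v (0 : Fin (Γ.length + 1))) (fun i : Fin Γ.length => v i.succ) := by
  funext i
  exact Fin.cases (motive := fun i => v i = consTup (s := s) (v (0 : Fin (Γ.length + 1)))
    (fun i : Fin Γ.length => v i.succ) i) rfl (fun _ => rfl) i

theorem map_consTup (f : ∀ s, M s → N s) {s : S} {Γ : List S} (a : M s) (v : Tup M Γ) :
    (fun i => f _ (consTup a v i)) = consTup (f s a) (fun i => f _ (v i)) := by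
  funext i
  exact Fin.cases (motive := fun i => f _ (consTup a v i) =
    consTup (f s a) (fun i => f _ (v i)) i) rfl (fun _ => rfl) i

theorem consTup_mem {D : SortedSet M} {s : S} {Γ : List S} {a : M s} {v : Tup M Γ}
    (ha : a ∈ D s) (hv : ∀ i, v i ∈ D (Γ.get i)) :
    ∀ i, consTup a v i ∈ D ((s :: Γ).get i) := fun i =>
  Fin.cases (motive := fun i => consTup a v i ∈ D ((s :: Γ).get i)) ha hv i

variable (𝓜 : L.Str M)

theorem Term.val_subst {Γ Δ : List S} (r : ∀ i : Fin Γ.length, L.Term Δ (Γ.get i)) (v : Tup M Δ)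
    {s : S} (t : L.Term Γ s) :
    (t.subst r).val 𝓜 v = t.val 𝓜 fun i => (r i).val 𝓜 v := by
  induction t with
  | var i => rfl
  | app f ts ih => simp only [Term.subst, Term.val, ih]

@[simp] theorem val_headVar {s : S} {Γ : List S} (a : M s) (v : Tup M Γ) :
    (headVar L s Γ).val 𝓜 (consTup a v) = a := rfl

@[simp] theorem Term.val_weak {s t : S} {Γ : List S} (τ : L.Term Γ t) (a : M s) (v : Tup M Γ) :
    (τ.weak s).val 𝓜 (consTup a v) = τ.val 𝓜 v := by
  rw [Term.weak, Term.val_subst]; rfl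

theorem val_consTerm {Δ Γ : List S} {s : S} (τ : L.Term Δ s)
    (r : ∀ i : Fin Γ.length, L.Term Δ (Γ.get i)) (v : Tup M Δ) :
    (fun i => (consTerm τ r i).val 𝓜 v) = consTup (τ.val 𝓜 v) (fun i => (r i).val 𝓜 v) := by
  funext i
  exact Fin.cases (motive := fun i => (consTerm τ r i).val 𝓜 v =
    consTup (τ.val 𝓜 v) (fun i => (r i).val 𝓜 v) i) rfl (fun _ => rfl) i

theorem val_liftSubst {s : S} {Δ Γ : List S} (r : ∀ i : Fin Γ.length, L.Term Δ (Γ.get i))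
    (a : M s) (v : Tup M Δ) :
    (fun i => (liftSubst s r i).val 𝓜 (consTup a v)) =
      consTup a (fun i => (r i).val 𝓜 v) := by
  rw [liftSubst, val_consTerm]; simp

@[simp] theorem sat_subst {Γ : List S} (φ : L.Formula Γ) : ∀ {Δ : List S}
    (r : ∀ i : Fin Γ.length, L.Term Δ (Γ.get i)) (v : Tup M Δ),
    𝓜.Sat (φ.subst r) v ↔ 𝓜.Sat φ fun i => (r i).val 𝓜 v := by
  induction φ with
  | falsum => intros; rfl
  | eq t₁ t₂ => intros; simp only [Formula.subst, Str.Sat, Term.val_subst]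
  | rel R ts => intros; simp only [Formula.subst, Str.Sat, Term.val_subst]
  | imp φ ψ ih₁ ih₂ => intros; simp only [Formula.subst, Str.Sat, ih₁, ih₂]
  | all s φ ih => intros; simp only [Formula.subst, Str.Sat, ih, val_liftSubst]

@[simp] theorem sat_not {Γ : List S} (φ : L.Formula Γ) (v : Tup M Γ) :
    𝓜.Sat φ.not v ↔ ¬ 𝓜.Sat φ v := Iff.rfl

@[simp] theorem sat_and {Γ : List S} (φ ψ : L.Formula Γ) (v : Tup M Γ) :
    𝓜.Sat (φ.and ψ) v ↔ 𝓜.Sat φ v ∧ 𝓜.Sat ψ v := by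
  simp [Formula.and, Formula.not, Str.Sat]

@[simp] theorem sat_ex {s : S} {Γ : List S} (φ : L.Formula (s :: Γ)) (v : Tup M Γ) :
    𝓜.Sat (φ.ex s) v ↔ ∃ a, 𝓜.Sat φ (consTup a v) := by
  simp [Formula.ex, Formula.not, Str.Sat]

@[simp] theorem sat_avoid {s : S} {Γ : List S} (φ : L.Formula (s :: Γ)) (a z : M s) (v : Tup M Γ) :
    𝓜.Sat φ.avoid (consTup a (consTup z v)) ↔ 𝓜.Sat φ (consTup a v) ∧ a ≠ z := by
  have h : (fun i : Fin Γ.length => (Term.var (L := L) (Γ := s :: Γ) i.succ).val 𝓜 (consTup z v)) = v := rfl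
  rw [Formula.avoid, sat_and, sat_subst, val_liftSubst, sat_not]
  erw [h]
  simp [Str.Sat]

theorem finite_of_sat_atMost {s : S} (k : ℕ) : ∀ {Γ : List S} (φ : L.Formula (s :: Γ)) (v : Tup M Γ),
    𝓜.Sat (φ.atMost k) v → {a | 𝓜.Sat φ (consTup a v)}.Finite := by
  induction k with
  | zero =>
    intro Γ φ v h
    convert Set.finite_empty
    exact Set.eq_empty_of_forall_notMem fun a ha => h a ha
  | succ k ih =>
    intro Γ φ v h
    obtain ⟨z, hz⟩ := (sat_ex 𝓜 _ _).1 h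
    refine ((ih _ _ hz).insert z).subset fun a ha => ?_
    by_cases hazz : a = z
    · exact .inl hazz
    · exact .inr ((sat_avoid 𝓜 _ _ _ _).2 ⟨ha, hazz⟩)

/-- Remove one solution at a time. The bound is existential because `atMost (k + 1)` asks for an
element of sort `s` and so fails in an empty sort, whatever `φ` is. -/
theorem exists_sat_atMost {s : S} (n : ℕ) : ∀ {Γ : List S} (φ : L.Formula (s :: Γ)) (v : Tup M Γ),
    {a | 𝓜.Sat φ (consTup a v)}.Finite → {a | 𝓜.Sat φ (consTup a v)}.ncard ≤ n →
    ∃ k, 𝓜.Sat (φ.atMost k) v := by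
  induction n with
  | zero =>
    intro Γ φ v hf hn
    have := (Set.ncard_eq_zero hf).1 (Nat.le_zero.1 hn)
    exact ⟨0, fun a ha => (this ▸ (show a ∈ {a | 𝓜.Sat φ (consTup a v)} from ha) : a ∈ (∅ : Set (M s)))⟩
  | succ n ih =>
    intro Γ φ v hf hn
    by_cases hne : ∃ z, 𝓜.Sat φ (consTup z v)
    · obtain ⟨z, hz⟩ := hne
      have heq : {a | 𝓜.Sat φ.avoid (consTup a (consTup z v))} =
          {a | 𝓜.Sat φ (consTup a v)} \ {z} := by
        ext a; simp
      obtain ⟨k, hk⟩ := ih φ.avoid (consTup z v) (heq ▸ hf.sdiff) (by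
        rw [heq, Set.ncard_sdiff_singleton_of_mem (show z ∈ {a | 𝓜.Sat φ (consTup a v)} from hz)]
        omega)
      exact ⟨k + 1, (sat_ex 𝓜 _ _).2 ⟨z, hk⟩⟩
    · exact ⟨0, fun a ha => hne ⟨a, ha⟩⟩

/-- An elementary map from `𝓜` to `𝓝` covers all solutions of formulas with finitely many
solutions in `𝓜`. -/
theorem mem_range_of_finite {𝓜 : L.Str M} {𝓝 : L.Str N} {e : ∀ s, M s → N s}
    (he : ElemOn 𝓜 𝓝 ⊤ e) {s : S} (n : ℕ) : ∀ {Γ : List S} (φ : L.Formula (s :: Γ)) (v : Tup M Γ),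
    {a | 𝓜.Sat φ (consTup a v)}.Finite → {a | 𝓜.Sat φ (consTup a v)}.ncard ≤ n →
    ∀ y : N s, 𝓝.Sat φ (consTup y fun i => e _ (v i)) →
      ∃ a, 𝓜.Sat φ (consTup a v) ∧ e s a = y := by
  induction n with
  | zero =>
    intro Γ φ v hf hn y hy
    have := (Set.ncard_eq_zero hf).1 (Nat.le_zero.1 hn)
    have h : 𝓜.Sat (.all s φ.not) v := fun a ha =>
      (this ▸ (show a ∈ {a | 𝓜.Sat φ (consTup a v)} from ha) : a ∈ (∅ : Set (M s)))
    exact ((he _ _ (fun _ => trivial)).1 h y hy).elim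
  | succ n ih =>
    intro Γ φ v hf hn y hy
    by_cases hne : ∃ z, 𝓜.Sat φ (consTup z v)
    · obtain ⟨z, hz⟩ := hne
      have heq : {a | 𝓜.Sat φ.avoid (consTup a (consTup z v))} =
          {a | 𝓜.Sat φ (consTup a v)} \ {z} := by
        ext a; simp
      by_cases hyz : e s z = y
      · exact ⟨z, hz, hyz⟩
      -- If `y` is not the image of the solution `z`, it still solves `φ.avoid` at that image, and
      -- `φ.avoid` at `z` has one solution fewer in `𝓜`.
      obtain ⟨a, ha, hay⟩ := ih φ.avoid (consTup z v) (heq ▸ hf.sdiff) (by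
        rw [heq, Set.ncard_sdiff_singleton_of_mem (show z ∈ {a | 𝓜.Sat φ (consTup a v)} from hz)]
        omega) y (by
          rw [map_consTup, sat_avoid]
          exact ⟨hy, fun h => hyz h.symm⟩)
      exact ⟨a, ((sat_avoid 𝓜 _ _ _ _).1 ha).1, hay⟩
    · have h : 𝓜.Sat (.all s φ.not) v := fun a ha => hne ⟨a, ha⟩
      exact ((he _ _ (fun _ => trivial)).1 h y hy).elim

end Semantics

/-! ### Algebraic and definable closure, generated substructures. -/

section Closures

variable {L : MSLang S} {M N : S → Type u} (𝓜 : L.Str M)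

theorem exists_eq_consTup {s : S} {Γ : List S} (v : Tup M (s :: Γ)) :
    ∃ (a : M s) (w : Tup M Γ), v = consTup a w :=
  ⟨_, _, eq_consTup v⟩

theorem forall_consTup {s : S} {Γ : List S} {a : M s} {v : Tup M Γ} {P : ∀ t, M t → Prop} :
    (∀ i, P ((s :: Γ).get i) (consTup a v i)) ↔ P s a ∧ ∀ i, P (Γ.get i) (v i) :=
  ⟨fun h => ⟨h (0 : Fin (Γ.length + 1)), fun i => h i.succ⟩, fun h i =>
    Fin.cases (motive := fun i => P ((s :: Γ).get i) (consTup a v i)) h.1 h.2 i⟩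

/-- Two tuples of parameters are given by terms (in fact variables) in a common tuple. -/
theorem exists_common_params {E : SortedSet M} {Γ₂ : List S} (p₂ : Tup M Γ₂)
    (h₂ : ∀ i, p₂ i ∈ E (Γ₂.get i)) : ∀ {Γ₁ : List S} (p₁ : Tup M Γ₁),
    (∀ i, p₁ i ∈ E (Γ₁.get i)) →
    ∃ (Γ : List S) (p : Tup M Γ) (r₁ : ∀ i : Fin Γ₁.length, L.Term Γ (Γ₁.get i))
      (r₂ : ∀ i : Fin Γ₂.length, L.Term Γ (Γ₂.get i)), (∀ i, p i ∈ E (Γ.get i)) ∧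
      (fun i => (r₁ i).val 𝓜 p) = p₁ ∧ (fun i => (r₂ i).val 𝓜 p) = p₂
  | [], p₁, _ => ⟨Γ₂, p₂, fun i => i.elim0, fun i => .var i, h₂, funext fun i => i.elim0, rfl⟩
  | s :: Γ₁, v, h => by
    obtain ⟨a, p₁, rfl⟩ := exists_eq_consTup v
    rw [forall_consTup (P := fun t x => x ∈ E t)] at h
    obtain ⟨Γ, p, r₁, r₂, hp, h₁', h₂'⟩ := exists_common_params p₂ h₂ p₁ h.2
    refine ⟨s :: Γ, consTup a p, liftSubst s r₁,
      fun i => (r₂ i).weak s, consTup_mem h.1 hp, ?_, ?_⟩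
    · rw [val_liftSubst, h₁']
    · simpa using h₂'

/-- A tuple of elements which are values of terms with parameters in `E` is given by terms in a
common tuple of parameters. -/
theorem exists_terms_of_forall {E : SortedSet M} : ∀ {Γ : List S} (v : Tup M Γ),
    (∀ i, ∃ (Δ : List S) (p : Tup M Δ) (τ : L.Term Δ (Γ.get i)),
      (∀ j, p j ∈ E (Δ.get j)) ∧ τ.val 𝓜 p = v i) →
    ∃ (Δ : List S) (p : Tup M Δ) (r : ∀ i : Fin Γ.length, L.Term Δ (Γ.get i)),
      (∀ j, p j ∈ E (Δ.get j)) ∧ (fun i => (r i).val 𝓜 p) = v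
  | [], v, _ => ⟨[], fun i => i.elim0, fun i => i.elim0, fun i => i.elim0,
      funext fun i => i.elim0⟩
  | s :: Γ, v, h => by
    obtain ⟨a, v, rfl⟩ := exists_eq_consTup v
    rw [forall_consTup (P := fun t x => ∃ (Δ : List S) (p : Tup M Δ) (τ : L.Term Δ t),
      (∀ j, p j ∈ E (Δ.get j)) ∧ τ.val 𝓜 p = x)] at h
    obtain ⟨Δ, p, r, hp, hr⟩ := exists_terms_of_forall v h.2
    obtain ⟨Δ', p', τ, hp', hτ⟩ := h.1
    obtain ⟨Θ, w, r₁, r₂, hw, h₁, h₂⟩ := exists_common_params 𝓜 p hp p' hp'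
    refine ⟨Θ, w, consTerm (τ.subst r₁) fun i => (r i).subst r₂, hw, ?_⟩
    rw [val_consTerm]
    simp only [Term.val_subst, h₁, h₂, hr, hτ]

/-- A tuple of elements of `E ∪ {c}` is given by terms in `c` and parameters from `E`, uniformly
under maps fixing `E`. -/
theorem exists_terms_of_mem_sup_single {E : SortedSet M} {s : S} {c : M s} :
    ∀ {Γ : List S} (v : Tup M Γ), (∀ i, v i ∈ (E ⊔ SortedSet.single c) (Γ.get i)) →
    ∃ (Δ : List S) (q : Tup M Δ) (r : ∀ i : Fin Γ.length, L.Term (s :: Δ) (Γ.get i)),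
      (∀ j, q j ∈ E (Δ.get j)) ∧ ∀ f : ∀ s, M s → M s, (∀ s, ∀ a ∈ E s, f s a = a) →
        (fun i => (r i).val 𝓜 (consTup (f s c) q)) = fun i => f _ (v i)
  | [], v, _ => ⟨[], fun i => i.elim0, fun i => i.elim0, fun i => i.elim0,
      fun _ _ => funext fun i => i.elim0⟩
  | t :: Γ, v, h => by
    obtain ⟨a, v, rfl⟩ := exists_eq_consTup v
    rw [forall_consTup (P := fun t x => x ∈ (E ⊔ SortedSet.single c) t)] at h
    obtain ⟨Δ, q, r, hq, hr⟩ := exists_terms_of_mem_sup_single v h.2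
    obtain ha | ha := h.1
    · refine ⟨t :: Δ, consTup a q, consTerm ((headVar L t Δ).weak s) fun i =>
        (r i).subst (liftSubst s fun i => .var (Γ := t :: Δ) i.succ), consTup_mem ha hq,
        fun f hf => ?_⟩
      rw [val_consTerm, map_consTup, ← hr f hf]
      simp only [Term.val_weak, val_headVar, Term.val_subst, val_liftSubst, hf t a ha]
      rfl
    · obtain ⟨rfl, ha⟩ := Sigma.mk.inj ha
      obtain rfl := eq_of_heq ha
      refine ⟨Δ, q, consTerm (headVar L t Δ) r, hq, fun f hf => ?_⟩
      rw [val_consTerm, map_consTup, ← hr f hf]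
      rfl

theorem acl_mono {A B : SortedSet M} (h : A ≤ B) : 𝓜.acl A ≤ 𝓜.acl B :=
  fun _ _ ⟨Γ, φ, p, hp, ha⟩ => ⟨Γ, φ, p, fun i => h _ (hp i), ha⟩

theorem dcl_mono {A B : SortedSet M} (h : A ≤ B) : 𝓜.dcl A ≤ 𝓜.dcl B :=
  fun _ _ ⟨Γ, φ, p, hp, ha⟩ => ⟨Γ, φ, p, fun i => h _ (hp i), ha⟩

theorem dcl_le_acl (A : SortedSet M) : 𝓜.dcl A ≤ 𝓜.acl A :=
  fun _ _ ⟨Γ, φ, p, hp, ha, h⟩ => ⟨Γ, φ, p, hp, ha, (Set.finite_singleton _).subset h⟩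

theorem le_dcl (A : SortedSet M) : A ≤ 𝓜.dcl A := fun s a ha =>
  ⟨[s], .eq (headVar L s [s]) ((headVar L s []).weak s), consTup a fun i => i.elim0,
    consTup_mem ha fun i => i.elim0, by simp [Str.Sat], fun b hb => by simpa [Str.Sat] using hb⟩

theorem le_acl (A : SortedSet M) : A ≤ 𝓜.acl A := (le_dcl 𝓜 A).trans (dcl_le_acl 𝓜 A)

/-- Quantify `c` out over the finitely many solutions `y` of its formula `ψ`. The conjunct `atMost
k` discards those `y` for which the formula for `b` might have infinitely many solutions, so what
remains is a finite union of finite sets; `k` is chosen so that `c` itself is kept. -/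
theorem acl_of_acl_sup_single {E : SortedSet M} {s t : S} {c : M s} {b : M t}
    (hc : c ∈ 𝓜.acl E s) (hb : b ∈ 𝓜.acl (E ⊔ SortedSet.single c) t) : b ∈ 𝓜.acl E t := by
  obtain ⟨Γ, φ, v, hv, hbφ, hfin⟩ := hb
  obtain ⟨Δ, q, r, hq, hr⟩ := exists_terms_of_mem_sup_single 𝓜 v hv
  replace hr := hr (fun _ a => a) fun _ _ _ => rfl
  obtain ⟨Δ', ψ, q', hq', hcψ, hfinψ⟩ := hc
  obtain ⟨Θ, w, r₂, r₁, hw, h₂, h₁⟩ := exists_common_params 𝓜 q hq q' hq'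
  let φ' : L.Formula (t :: s :: Θ) :=
    φ.subst (liftSubst t fun i => (r i).subst (liftSubst s r₁))
  have hφ' : ∀ x y, 𝓜.Sat φ' (consTup x (consTup y w)) ↔
      𝓜.Sat φ (consTup x fun i => (r i).val 𝓜 (consTup y q)) := fun x y => by
    simp only [φ', sat_subst, val_liftSubst, Term.val_subst, h₁]
  obtain ⟨k, hk⟩ := exists_sat_atMost 𝓜 _ φ' (consTup c w)
    (by simpa only [hφ', hr] using hfin) le_rfl
  let out : ∀ i : Fin Θ.length, L.Term (s :: t :: Θ) (Θ.get i) :=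
    fun i => ((Term.var i).weak t).weak s
  have hout : ∀ x y, (fun i => (out i).val 𝓜 (consTup y (consTup x w))) = w := fun x y => by
    simp [out, Term.val]
  let χ : L.Formula (t :: Θ) := .ex s <|
    ((ψ.subst (liftSubst s r₂)).subst (consTerm (headVar L s _) out)).and <|
      (φ'.subst (consTerm ((headVar L t Θ).weak s) (consTerm (headVar L s _) out))).and <|
        (φ'.atMost k).subst (consTerm (headVar L s _) out)
  have hχ : ∀ x, 𝓜.Sat χ (consTup x w) ↔ ∃ y, 𝓜.Sat ψ (consTup y q') ∧
      𝓜.Sat φ' (consTup x (consTup y w)) ∧ 𝓜.Sat (φ'.atMost k) (consTup y w) := fun x => by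
    simp only [χ, sat_ex, sat_and, sat_subst, val_consTerm, val_headVar, Term.val_weak, hout,
      val_liftSubst, h₂]
  refine ⟨Θ, χ, w, hw, (hχ b).2 ⟨c, hcψ, (hφ' _ _).2 (by rwa [hr]), hk⟩, ?_⟩
  refine (hfinψ.biUnion (t := fun y => {x | 𝓜.Sat (φ'.atMost k) (consTup y w) ∧
    𝓜.Sat φ' (consTup x (consTup y w))}) fun y _ => ?_).subset fun x hx => ?_
  · by_cases hy : 𝓜.Sat (φ'.atMost k) (consTup y w)
    · exact (finite_of_sat_atMost 𝓜 k φ' _ hy).subset fun x hx => hx.2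
    · exact Set.finite_empty.subset fun x hx => hy hx.1
  · obtain ⟨y, hy, hxy, hyk⟩ := (hχ x).1 hx
    exact Set.mem_biUnion (show y ∈ {y | 𝓜.Sat ψ (consTup y q')} from hy) ⟨hyk, hxy⟩

/-- The set of entries of a tuple. -/
def rangeTup {Γ : List S} (p : Tup M Γ) : SortedSet M :=
  fun s => {a | ∃ i, (⟨Γ.get i, p i⟩ : Σ s, M s) = ⟨s, a⟩}

theorem mem_rangeTup {Γ : List S} (p : Tup M Γ) (i) : p i ∈ rangeTup p (Γ.get i) := ⟨i, rfl⟩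

theorem rangeTup_le {Γ : List S} {p : Tup M Γ} {A : SortedSet M} (h : ∀ i, p i ∈ A (Γ.get i)) :
    rangeTup p ≤ A := by
  rintro s a ⟨i, hi⟩
  cases hi
  exact h i

theorem acl_of_acl_sup_range {E : SortedSet M} : ∀ {Γ : List S} (p : Tup M Γ),
    (∀ i, p i ∈ 𝓜.acl E (Γ.get i)) → 𝓜.acl (E ⊔ rangeTup p) ≤ 𝓜.acl E
  | [], p, _ => acl_mono 𝓜 (sup_le le_rfl (rangeTup_le fun i => i.elim0))
  | s :: Γ, v, h => by
    obtain ⟨c, p, rfl⟩ := exists_eq_consTup v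
    rw [forall_consTup (P := fun t x => x ∈ 𝓜.acl E t)] at h
    refine le_trans ?_ (acl_of_acl_sup_range p h.2)
    intro t b hb
    refine acl_of_acl_sup_single 𝓜 (acl_mono 𝓜 le_sup_left _ h.1) (acl_mono 𝓜 ?_ _ hb)
    refine sup_le (le_sup_left.trans le_sup_left) (rangeTup_le fun i => ?_)
    refine forall_consTup (P := fun t x => x ∈ (E ⊔ rangeTup p ⊔ SortedSet.single c) t) |>.2
      ⟨.inr rfl, fun i => .inl (.inr (mem_rangeTup p i))⟩ i

theorem acl_acl (E : SortedSet M) : 𝓜.acl (𝓜.acl E) = 𝓜.acl E := by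
  refine le_antisymm (fun s a ha => ?_) (le_acl 𝓜 _)
  obtain ⟨Γ, φ, p, hp, ha⟩ := ha
  exact acl_of_acl_sup_range 𝓜 p hp _ ⟨Γ, φ, p, fun i => .inr (mem_rangeTup p i), ha⟩

/-- The value `f(v)` is definable over `v`, so transitivity of `acl` applies. -/
theorem closed_acl (E : SortedSet M) : 𝓜.Closed (𝓜.acl E) := by
  intro σ s f v hv
  rw [← acl_acl]
  refine dcl_le_acl _ _ _ ⟨σ, .eq (headVar L s σ) (.app f fun i => (Term.var i).weak s), v, hv,
    ?_, fun b hb => ?_⟩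
  · simp [Str.Sat, Term.val]
  · simpa [Str.Sat, Term.val] using hb

theorem le_gen (A : SortedSet M) : A ≤ 𝓜.gen A := fun _ _ ha _ _ h => h _ ha

theorem closed_gen (A : SortedSet M) : 𝓜.Closed (𝓜.gen A) := fun f v hv B hB h =>
  hB f v fun i => hv i B hB h

theorem gen_le {A B : SortedSet M} (hB : 𝓜.Closed B) (h : A ≤ B) : 𝓜.gen A ≤ B :=
  fun _ _ ha => ha B hB h

theorem gen_mono {A B : SortedSet M} (h : A ≤ B) : 𝓜.gen A ≤ 𝓜.gen B :=
  gen_le 𝓜 (closed_gen 𝓜 B) (h.trans (le_gen 𝓜 B))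

/-- The values of terms at tuples from `A` form a closed set containing `A`. -/
theorem exists_term_of_mem_gen {A : SortedSet M} {s : S} {a : M s} (ha : a ∈ 𝓜.gen A s) :
    ∃ (Δ : List S) (p : Tup M Δ) (τ : L.Term Δ s), (∀ j, p j ∈ A (Δ.get j)) ∧ τ.val 𝓜 p = a := by
  refine gen_le 𝓜 (B := fun s => {a | ∃ (Δ : List S) (p : Tup M Δ) (τ : L.Term Δ s),
    (∀ j, p j ∈ A (Δ.get j)) ∧ τ.val 𝓜 p = a}) ?_ ?_ s ha
  · intro σ s f v hv
    obtain ⟨Δ, p, r, hp, hr⟩ := exists_terms_of_forall 𝓜 v hv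
    exact ⟨Δ, p, .app f r, hp, by rw [← hr]; rfl⟩
  · exact fun s a ha => ⟨[s], consTup a fun i => i.elim0, headVar L s [],
      consTup_mem ha fun i => i.elim0, rfl⟩

/-- A set definable over `gen A` is definable over `A`. -/
theorem exists_formula_of_mem_gen {A : SortedSet M} {s : S} {Γ : List S} (φ : L.Formula (s :: Γ))
    (v : Tup M Γ) (hv : ∀ i, v i ∈ 𝓜.gen A (Γ.get i)) :
    ∃ (Δ : List S) (ψ : L.Formula (s :: Δ)) (p : Tup M Δ), (∀ i, p i ∈ A (Δ.get i)) ∧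
      ∀ a, 𝓜.Sat ψ (consTup a p) ↔ 𝓜.Sat φ (consTup a v) := by
  obtain ⟨Δ, p, r, hp, rfl⟩ := exists_terms_of_forall 𝓜 v fun i => exists_term_of_mem_gen 𝓜 (hv i)
  exact ⟨Δ, φ.subst (liftSubst s r), p, hp, fun a => by rw [sat_subst, val_liftSubst]⟩

theorem acl_gen (A : SortedSet M) : 𝓜.acl (𝓜.gen A) = 𝓜.acl A := by
  refine le_antisymm ?_ (acl_mono 𝓜 (le_gen 𝓜 A))
  rintro s a ⟨Γ, φ, v, hv, ha, h⟩
  obtain ⟨Δ, ψ, p, hp, hψ⟩ := exists_formula_of_mem_gen 𝓜 φ v hv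
  exact ⟨Δ, ψ, p, hp, (hψ a).2 ha, by simpa only [hψ] using h⟩

theorem dcl_gen_le (A : SortedSet M) : 𝓜.dcl (𝓜.gen A) ≤ 𝓜.dcl A := by
  rintro s a ⟨Γ, φ, v, hv, ha, h⟩
  obtain ⟨Δ, ψ, p, hp, hψ⟩ := exists_formula_of_mem_gen 𝓜 φ v hv
  exact ⟨Δ, ψ, p, hp, (hψ a).2 ha, by simpa only [hψ] using h⟩

/-- An element algebraic but not definable over `E` has a conjugate over `E`. -/
theorem exists_conjugate {E : SortedSet M} {s : S} {b : M s} (hb : b ∈ 𝓜.acl E s)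
    (hb' : b ∉ 𝓜.dcl E s) : ∃ b', b' ≠ b ∧ ∀ {Γ : List S} (θ : L.Formula (s :: Γ)) (p : Tup M Γ),
      (∀ i, p i ∈ E (Γ.get i)) → (𝓜.Sat θ (consTup b p) ↔ 𝓜.Sat θ (consTup b' p)) := by
  classical
  -- A formula over `E` true of `b` with the fewest solutions isolates the type of `b`: a formula
  -- separating `b` from another solution `b'` would cut the solution set down further.
  let P : ℕ → Prop := fun n => ∃ (Γ : List S) (φ : L.Formula (s :: Γ)) (p : Tup M Γ),
    (∀ i, p i ∈ E (Γ.get i)) ∧ 𝓜.Sat φ (consTup b p) ∧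
    {b : M s | 𝓜.Sat φ (consTup b p)}.Finite ∧ {b : M s | 𝓜.Sat φ (consTup b p)}.ncard = n
  have hP : ∃ n, P n := by
    obtain ⟨Γ, φ, p, hp, h, hfin⟩ := hb
    exact ⟨_, Γ, φ, p, hp, h, hfin, rfl⟩
  obtain ⟨Γ, φ, p, hp, hφ, hfin, hn⟩ := Nat.find_spec hP
  obtain ⟨b', hb'φ, hne⟩ : ∃ b', 𝓜.Sat φ (consTup b' p) ∧ b' ≠ b := by
    by_contra! h
    exact hb' ⟨Γ, φ, p, hp, hφ, h⟩
  have key : ∀ {Δ : List S} (θ : L.Formula (s :: Δ)) (q : Tup M Δ), (∀ i, q i ∈ E (Δ.get i)) →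
      𝓜.Sat θ (consTup b q) → 𝓜.Sat θ (consTup b' q) := by
    intro Δ θ q hq hθ
    by_contra hθ'
    obtain ⟨Θ, w, r₁, r₂, hw, h₁, h₂⟩ := exists_common_params 𝓜 p hp q hq
    have hs : ∀ x, 𝓜.Sat ((φ.subst (liftSubst s r₂)).and (θ.subst (liftSubst s r₁)))
        (consTup x w) ↔ 𝓜.Sat φ (consTup x p) ∧ 𝓜.Sat θ (consTup x q) := fun x => by
      simp only [sat_and, sat_subst, val_liftSubst, h₁, h₂]
    have hlt : {x | 𝓜.Sat φ (consTup x p) ∧ 𝓜.Sat θ (consTup x q)}.ncard < Nat.find hP := by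
      rw [← hn]
      exact Set.ncard_lt_ncard ⟨fun x hx => hx.1, fun h => hθ' (h hb'φ).2⟩ hfin
    refine Nat.find_min hP hlt ⟨Θ, _, w, hw, (hs b).2 ⟨hφ, hθ⟩, ?_, ?_⟩
    · simpa only [hs] using hfin.subset fun x hx => hx.1
    · simp only [hs]
  refine ⟨b', hne, fun θ q hq => ⟨key θ q hq, fun h => ?_⟩⟩
  by_contra hc
  exact key θ.not q hq hc h

end Closures

/-! ### Embeddings, elementary maps and reducts. -/

section Embeddings

variable {L L₀ : MSLang S} {M N K : S → Type u} {𝓜 : L.Str M} {𝓝 : L.Str N} {𝓚 : L.Str K}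
  {f : ∀ s, M s → N s}

theorem IsEmb.comp {g : ∀ s, N s → K s} (hg : IsEmb 𝓝 𝓚 g) (hf : IsEmb 𝓜 𝓝 f) :
    IsEmb 𝓜 𝓚 fun s a => g s (f s a) where
  injective s := (hg.injective s).comp (hf.injective s)
  map_fn F v := by rw [hf.map_fn, hg.map_fn]
  map_rel R v := by rw [hf.map_rel, hg.map_rel]

theorem IsEmb.of_comp {g : ∀ s, N s → K s} (hg : IsEmb 𝓝 𝓚 g)
    (h : IsEmb 𝓜 𝓚 fun s a => g s (f s a)) : IsEmb 𝓜 𝓝 f where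
  injective s := (h.injective s).of_comp (f := g s)
  map_fn F v := hg.injective _ (by rw [h.map_fn, hg.map_fn])
  map_rel R v := by rw [h.map_rel, hg.map_rel]

theorem IsEmb.map_val (hf : IsEmb 𝓜 𝓝 f) {Γ : List S} (v : Tup M Γ) {s : S} (t : L.Term Γ s) :
    f s (t.val 𝓜 v) = t.val 𝓝 fun i => f _ (v i) := by
  induction t with
  | var i => rfl
  | app F ts ih => simp only [Term.val, hf.map_fn, ih]

theorem IsEmb.sat_of_isQF (hf : IsEmb 𝓜 𝓝 f) {Γ : List S} {φ : L.Formula Γ} (hφ : φ.IsQF)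
    (v : Tup M Γ) : 𝓜.Sat φ v ↔ 𝓝.Sat φ fun i => f _ (v i) := by
  induction hφ with
  | falsum => rfl
  | eq t₁ t₂ => simp only [Str.Sat, ← hf.map_val, (hf.injective _).eq_iff]
  | rel R ts => simp only [Str.Sat, ← hf.map_val, hf.map_rel]
  | imp _ _ ih₁ ih₂ => simp only [Str.Sat, ih₁, ih₂]

theorem IsEmb.sat_of_isUniversal (hf : IsEmb 𝓜 𝓝 f) {Γ : List S} {φ : L.Formula Γ}
    (hφ : φ.IsUniversal) (v : Tup M Γ) (h : 𝓝.Sat φ fun i => f _ (v i)) : 𝓜.Sat φ v := by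
  induction hφ with
  | of_qf hφ => exact (hf.sat_of_isQF hφ v).2 h
  | all _ ih =>
    intro a
    refine ih _ ?_
    rw [map_consTup]
    exact h _

theorem IsEmb.elemOn_of_surjective (hf : IsEmb 𝓜 𝓝 f) (hs : ∀ s, Function.Surjective (f s)) :
    ElemOn 𝓜 𝓝 ⊤ f := by
  intro Γ φ v _
  induction φ with
  | falsum => rfl
  | eq t₁ t₂ => simp only [Str.Sat, ← hf.map_val, (hf.injective _).eq_iff]
  | rel R ts => simp only [Str.Sat, ← hf.map_val, hf.map_rel]
  | imp _ _ ih₁ ih₂ =>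
    simp only [Str.Sat, ih₁ v (fun _ => trivial), ih₂ v (fun _ => trivial)]
  | all s φ ih =>
    simp only [Str.Sat, ih _ (fun _ => trivial), map_consTup, (hs s).forall]

theorem ElemOn.holds_iff {D : SortedSet M} (h : ElemOn 𝓜 𝓝 D f) (φ : L.Sentence) :
    𝓜.Holds φ ↔ 𝓝.Holds φ := by
  have := h φ (fun i => i.elim0) fun i => i.elim0
  rwa [show (fun i => f _ ((fun i => i.elim0 : Tup M []) i)) = (fun i => i.elim0 : Tup N [])
    from funext fun i => i.elim0] at this

theorem ElemOn.models_iff {D : SortedSet M} (h : ElemOn 𝓜 𝓝 D f) (T : L.Theory) :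
    𝓜.Models T ↔ 𝓝.Models T := by
  simp only [Str.Models, h.holds_iff]

theorem ElemOn.mono {D D' : SortedSet M} (h : ElemOn 𝓜 𝓝 D f) (hD : D' ≤ D) :
    ElemOn 𝓜 𝓝 D' f := fun φ v hv => h φ v fun i => hD _ (hv i)

theorem IsEmb.models_univPart (hf : IsEmb 𝓜 𝓝 f) {T : L.Theory} (h : 𝓝.Models T) :
    𝓜.Models T.univPart := by
  intro φ hφ
  refine hf.sat_of_isUniversal hφ.1 _ ?_
  convert hφ.2 N 𝓝 h using 1
  exact iff_of_eq (congrArg _ (funext fun i => i.elim0))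

theorem Incl.val_term (ι : L₀.Incl L) (𝓜 : L.Str M) {Γ : List S} (v : Tup M Γ) {s : S}
    (t : L₀.Term Γ s) : (ι.term t).val 𝓜 v = t.val (𝓜.reduct ι) v := by
  induction t with
  | var i => rfl
  | app F ts ih => simp only [Incl.term, Term.val, ih]; rfl

theorem Incl.sat_formula (ι : L₀.Incl L) (𝓜 : L.Str M) {Γ : List S} (φ : L₀.Formula Γ)
    (v : Tup M Γ) : 𝓜.Sat (ι.formula φ) v ↔ (𝓜.reduct ι).Sat φ v := by
  induction φ with
  | falsum => rfl
  | eq t₁ t₂ => simp only [Incl.formula, Str.Sat, Incl.val_term]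
  | rel R ts => simp only [Incl.formula, Str.Sat, Incl.val_term]; rfl
  | imp _ _ ih₁ ih₂ => simp only [Incl.formula, Str.Sat, ih₁, ih₂]
  | all s φ ih => simp only [Incl.formula, Str.Sat, ih]

end Embeddings

/-! ### Cardinality of inductively generated sets. -/

section Generation

variable {Y α : Type u} {β : α → Type}

/-- The closure of the empty set under a family of partial functions, given by their graphs. -/
inductive Generated (R : ∀ a, (β a → Y) → Y → Prop) : Y → Prop
  | mk (a : α) (c : β a → Y) (y : Y) : (∀ i, Generated R (c i)) → R a c y → Generated R y

/-- `w` is a construction of `y`. -/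
def Constructs (R : ∀ a, (β a → Y) → Y → Prop) : WType β → Y → Prop
  | .mk a w, y => ∃ c, (∀ i, Constructs R (w i) (c i)) ∧ R a c y

/-- Every generated element has a construction tree, and the tree determines the element because `R`
is functional. There are at most `max #α ℵ₀` well-founded trees with finite branching and labels in
`α`. -/
theorem card_generated_le (R : ∀ a, (β a → Y) → Y → Prop) [∀ a, Finite (β a)]
    (hR : ∀ a c y y', R a c y → R a c y' → y = y') :
    #{y // Generated R y} ≤ max #α ℵ₀ := by
  have hfun : ∀ (w : WType β) (y y' : Y), Constructs R w y → Constructs R w y' → y = y' := by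
    intro w
    induction w with
    | mk a w ih =>
      rintro y y' ⟨c, hc, h⟩ ⟨c', hc', h'⟩
      obtain rfl : c = c' := funext fun i => ih i _ _ (hc i) (hc' i)
      exact hR _ _ _ _ h h'
  have hex : ∀ y, Generated R y → ∃ w, Constructs R w y := by
    intro y hy
    induction hy with
    | mk a c y _ h ih =>
      choose w hw using ih
      exact ⟨.mk a w, c, hw, h⟩
  choose code hcode using hex
  refine (Cardinal.mk_le_of_injective (f := fun y : {y // Generated R y} => code y.1 y.2)
    fun y y' h => Subtype.ext (hfun _ _ _ (hcode y.1 y.2) ?_)).trans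
    (WType.cardinalMk_le_max_aleph0_of_finite'.trans_eq (by rw [lift_uzero]))
  simp only at h
  rw [h]
  exact hcode y'.1 y'.2

end Generation

/-! ### The number of formulas. -/

section Counting

variable (L : MSLang S)

/-- Terms and formulas. -/
inductive Expr : Type u
  | term {Γ : List S} {s : S} (t : L.Term Γ s)
  | formula {Γ : List S} (φ : L.Formula Γ)

/-- The labels of the nodes of a syntax tree. -/
inductive Label : Type u
  | var (Γ : List S) (n : ℕ)
  | app (Γ : List S) (F : Σ σ, Σ s, L.Fn σ s)
  | falsum (Γ : List S)
  | eq
  | rel (Γ : List S) (R : Σ σ, L.Rel σ)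
  | imp
  | all

variable {L}

/-- The index type of the subtrees of a node. -/
def Label.Arity : L.Label → Type
  | .var _ _ => Fin 0
  | .app _ F => Fin F.1.length
  | .falsum _ => Fin 0
  | .eq => Fin 2
  | .rel _ R => Fin R.1.length
  | .imp => Fin 2
  | .all => Fin 1

instance (a : L.Label) : Finite a.Arity := by
  cases a <;> unfold Label.Arity <;> infer_instance

/-- The expression `y` has the label `a` at its root, and immediate subexpressions `c`. -/
def Label.Step : ∀ a : L.Label, (a.Arity → L.Expr) → L.Expr → Prop
  | .var Γ n, _, y => ∃ h : n < Γ.length, y = .term (.var ⟨n, h⟩)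
  | .app Γ F, c, y => ∃ ts : ∀ i : Fin F.1.length, L.Term Γ (F.1.get i),
      (∀ i, c i = .term (ts i)) ∧ y = .term (.app F.2.2 ts)
  | .falsum Γ, _, y => y = .formula (.falsum : L.Formula Γ)
  | .eq, c, y => ∃ (Γ : List S) (s : S) (t₁ t₂ : L.Term Γ s),
      c (0 : Fin 2) = .term t₁ ∧ c (1 : Fin 2) = .term t₂ ∧ y = .formula (.eq t₁ t₂)
  | .rel Γ R, c, y => ∃ ts : ∀ i : Fin R.1.length, L.Term Γ (R.1.get i),
      (∀ i, c i = .term (ts i)) ∧ y = .formula (.rel R.2 ts)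
  | .imp, c, y => ∃ (Γ : List S) (φ ψ : L.Formula Γ),
      c (0 : Fin 2) = .formula φ ∧ c (1 : Fin 2) = .formula ψ ∧ y = .formula (.imp φ ψ)
  | .all, c, y => ∃ (Γ : List S) (s : S) (φ : L.Formula (s :: Γ)),
      c (0 : Fin 1) = .formula φ ∧ y = .formula (.all s φ)

/-- Labels of nodes that may have no subexpressions must record the context `Γ`; for `eq`, `imp` and
`all` it can be read off a subexpression. -/
theorem Label.step_functional (a : L.Label) (c : a.Arity → L.Expr) (y y' : L.Expr)
    (h : a.Step c y) (h' : a.Step c y') : y = y' := by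
  cases a with
  | var Γ n => obtain ⟨_, rfl⟩ := h; obtain ⟨_, rfl⟩ := h'; rfl
  | app Γ F =>
    obtain ⟨ts, hc, rfl⟩ := h
    obtain ⟨ts', hc', rfl⟩ := h'
    obtain rfl : ts = ts' := funext fun i => by
      simpa using (hc i).symm.trans (hc' i)
    rfl
  | falsum Γ => exact Eq.trans h (Eq.symm h')
  | eq =>
    obtain ⟨Γ, s, t₁, t₂, h₁, h₂, rfl⟩ := h
    obtain ⟨Γ', s', t₁', t₂', h₁', h₂', rfl⟩ := h'
    cases h₁.symm.trans h₁'
    cases h₂.symm.trans h₂'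
    rfl
  | rel Γ R =>
    obtain ⟨ts, hc, rfl⟩ := h
    obtain ⟨ts', hc', rfl⟩ := h'
    obtain rfl : ts = ts' := funext fun i => by
      simpa using (hc i).symm.trans (hc' i)
    rfl
  | imp =>
    obtain ⟨Γ, φ, ψ, h₁, h₂, rfl⟩ := h
    obtain ⟨Γ', φ', ψ', h₁', h₂', rfl⟩ := h'
    cases h₁.symm.trans h₁'
    cases h₂.symm.trans h₂'
    rfl
  | all =>
    obtain ⟨Γ, s, φ, h₁, rfl⟩ := h
    obtain ⟨Γ', s', φ', h₁', rfl⟩ := h'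
    cases h₁.symm.trans h₁'
    rfl

theorem generated_term {Γ : List S} {s : S} (t : L.Term Γ s) :
    Generated Label.Step (Expr.term t) := by
  induction t with
  | var i => exact .mk (Label.var Γ i : L.Label) (fun i => Fin.elim0 i) _ (fun i => Fin.elim0 i) ⟨i.2, rfl⟩
  | @app σ _ F ts ih =>
    exact .mk (Label.app Γ ⟨_, _, F⟩ : L.Label) (fun i : Fin σ.length => Expr.term (ts i)) _
      (fun i => ih i) ⟨ts, fun _ => rfl, rfl⟩

theorem generated_formula {Γ : List S} (φ : L.Formula Γ) :
    Generated Label.Step (Expr.formula φ) := by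
  induction φ with
  | falsum => exact .mk (Label.falsum _ : L.Label) (fun i => Fin.elim0 i) _ (fun i => Fin.elim0 i) rfl
  | eq t₁ t₂ =>
    refine .mk (Label.eq : L.Label) (fun (i : Fin 2) => if i = 0 then .term t₁ else .term t₂) _ (fun (i : Fin 2) => ?_)
      ⟨_, _, t₁, t₂, rfl, rfl, rfl⟩
    split <;> exact generated_term _
  | rel R ts =>
    exact .mk (Label.rel _ ⟨_, R⟩ : L.Label) (fun i => .term (ts i)) _ (fun i => generated_term _)
      ⟨ts, fun _ => rfl, rfl⟩
  | imp φ ψ ih₁ ih₂ =>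
    refine .mk (Label.imp : L.Label) (fun (i : Fin 2) => if i = 0 then .formula φ else .formula ψ) _ (fun (i : Fin 2) => ?_)
      ⟨_, φ, ψ, rfl, rfl, rfl⟩
    split <;> assumption
  | all s φ ih => exact .mk (Label.all : L.Label) (fun _ => .formula φ) _ (fun _ => ih) ⟨_, _, φ, rfl, rfl⟩

variable (L)

theorem aleph0_le_card : ℵ₀ ≤ L.card := le_max_left _ _

theorem card_sorts_le : #S ≤ L.card :=
  le_max_of_le_right (le_add_right (le_add_right le_rfl))

theorem card_list_le : #(List S) ≤ L.card :=
  (mk_list_le_max S).trans (max_le L.aleph0_le_card L.card_sorts_le)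

theorem card_label_le : #L.Label ≤ L.card := by
  let f : (((List S × ℕ) ⊕ (List S × (Σ σ, Σ s, L.Fn σ s))) ⊕
      ((List S × (Σ σ, L.Rel σ)) ⊕ (List S ⊕ Fin 3))) → L.Label
    | .inl (.inl x) => .var x.1 x.2
    | .inl (.inr x) => .app x.1 x.2
    | .inr (.inl x) => .rel x.1 x.2
    | .inr (.inr (.inl x)) => .falsum x
    | .inr (.inr (.inr 0)) => .eq
    | .inr (.inr (.inr 1)) => .imp
    | .inr (.inr (.inr 2)) => .all
  have hf : Function.Surjective f := by
    rintro (⟨Γ, n⟩ | ⟨Γ, F⟩ | Γ | _ | ⟨Γ, R⟩ | _ | _)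
    · exact ⟨.inl (.inl (Γ, n)), rfl⟩
    · exact ⟨.inl (.inr (Γ, F)), rfl⟩
    · exact ⟨.inr (.inr (.inl Γ)), rfl⟩
    · exact ⟨.inr (.inr (.inr 0)), rfl⟩
    · exact ⟨.inr (.inl (Γ, R)), rfl⟩
    · exact ⟨.inr (.inr (.inr 1)), rfl⟩
    · exact ⟨.inr (.inr (.inr 2)), rfl⟩
  refine (mk_le_of_surjective hf).trans ?_
  have h₀ := L.aleph0_le_card
  have h₁ := L.card_list_le
  have hF : #(Σ σ, Σ s, L.Fn σ s) ≤ L.card :=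
    le_max_of_le_right (le_add_right (le_add_left le_rfl))
  have hR : #(Σ σ, L.Rel σ) ≤ L.card := le_max_of_le_right (le_add_left le_rfl)
  have h3 : lift.{u} #(Fin 3) ≤ L.card := by
    simpa using (natCast_lt_aleph0 (n := 3)).le.trans h₀
  have hN : lift.{u} #ℕ ≤ L.card := by simpa using h₀
  have hmul : ∀ a b : Cardinal.{u}, a ≤ L.card → b ≤ L.card → a * b ≤ L.card := fun a b ha hb =>
    (mul_le_mul' ha hb).trans (mul_eq_self h₀).le
  simp only [mk_sum, mk_prod, lift_uzero, lift_id]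
  refine add_le_of_le h₀ (add_le_of_le h₀ ?_ ?_) (add_le_of_le h₀ ?_ (add_le_of_le h₀ ?_ ?_))
  · exact hmul _ _ h₁ hN
  · exact hmul _ _ h₁ hF
  · exact hmul _ _ h₁ hR
  · exact h₁
  · exact h3

theorem card_formula_le : #(Σ Γ, L.Formula Γ) ≤ L.card := by
  refine (Cardinal.mk_le_of_injective (f := fun φ : Σ Γ, L.Formula Γ =>
    (⟨Expr.formula φ.2, generated_formula φ.2⟩ : {y // Generated Label.Step y}))
    fun φ ψ h => ?_).trans ((card_generated_le _ Label.step_functional).trans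
      (max_le L.card_label_le L.aleph0_le_card))
  obtain ⟨Γ, φ⟩ := φ
  obtain ⟨Δ, ψ⟩ := ψ
  cases congrArg Subtype.val h
  rfl

end Counting

/-! ### The Tarski-Vaught test and Skolem hulls. -/

section Skolem

variable {L : MSLang S} {M N : S → Type u} {𝓜 : L.Str M} {𝓝 : L.Str N}

/-- The Tarski-Vaught test. -/
theorem IsEmb.elemOn_of_witness {e : ∀ s, N s → M s} (he : IsEmb 𝓝 𝓜 e)
    (h : ∀ {Γ : List S} {s : S} (φ : L.Formula (s :: Γ)) (v : Tup N Γ) (a : M s),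
      𝓜.Sat φ (consTup a fun i => e _ (v i)) →
      ∃ b : N s, 𝓜.Sat φ (consTup (e s b) fun i => e _ (v i))) : ElemOn 𝓝 𝓜 ⊤ e := by
  intro Γ φ v _
  induction φ with
  | falsum => rfl
  | eq t₁ t₂ => simp only [Str.Sat, ← he.map_val, (he.injective _).eq_iff]
  | rel R ts => simp only [Str.Sat, ← he.map_val, he.map_rel]
  | imp _ _ ih₁ ih₂ =>
    simp only [Str.Sat, ih₁ v (fun _ => trivial), ih₂ v (fun _ => trivial)]
  | all s φ ih =>
    simp only [Str.Sat, ih _ (fun _ => trivial), map_consTup]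
    refine ⟨fun hN a => ?_, fun hM b => hM _⟩
    by_contra ha
    obtain ⟨b, hb⟩ := h φ.not v a ha
    exact hb (hN b)

/-- The labels of the generation of a Skolem hull. -/
abbrev SkolemLabel (L : MSLang S) {M : S → Type u} (A : SortedSet M) : Type u :=
  (Σ s, A s) ⊕ (Σ s : S, Σ Γ : List S, L.Formula (s :: Γ))

/-- The number of arguments of a generation step. -/
def SkolemLabel.Arity {A : SortedSet M} : SkolemLabel L A → Type
  | .inl _ => Fin 0
  | .inr φ => Fin φ.2.1.length

instance {A : SortedSet M} (a : SkolemLabel L A) : Finite (SkolemLabel.Arity a) := by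
  cases a <;> unfold SkolemLabel.Arity <;> infer_instance

/-- Generation of the Skolem hull. -/
def SkolemStep (𝓜 : L.Str M) (A : SortedSet M) :
    ∀ a : SkolemLabel L A, (SkolemLabel.Arity a → Σ s, M s) → (Σ s, M s) → Prop
  | .inl a, _, y => y = ⟨a.1, a.2.1⟩
  | .inr φ, c, y => ∃ v : Tup M φ.2.1, (∀ i : Fin φ.2.1.length, c i = ⟨_, v i⟩) ∧
      ∃ h : ∃ a, 𝓜.Sat φ.2.2 (consTup a v), y = ⟨φ.1, h.choose⟩

/-- The Skolem hull of a set. -/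
def Str.hull (𝓜 : L.Str M) (A : SortedSet M) : SortedSet M :=
  fun s => {a | Generated (SkolemStep 𝓜 A) ⟨s, a⟩}

theorem le_hull (A : SortedSet M) : A ≤ 𝓜.hull A := fun s a ha =>
  .mk (Sum.inl ⟨s, a, ha⟩ : SkolemLabel L A) (fun i => Fin.elim0 i) _ (fun i => Fin.elim0 i) rfl

theorem exists_mem_hull {A : SortedSet M} {s : S} {Γ : List S} (φ : L.Formula (s :: Γ))
    (v : Tup M Γ) (hv : ∀ i, v i ∈ 𝓜.hull A (Γ.get i)) (h : ∃ a, 𝓜.Sat φ (consTup a v)) :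
    ∃ a ∈ 𝓜.hull A s, 𝓜.Sat φ (consTup a v) := by
  let c : SkolemLabel.Arity (Sum.inr ⟨s, Γ, φ⟩ : SkolemLabel L A) → Σ s, M s :=
    fun i : Fin Γ.length => ⟨Γ.get i, v i⟩
  exact ⟨h.choose, .mk _ c _ hv ⟨v, fun _ => rfl, h, rfl⟩, h.choose_spec⟩

/-- The only witness of `x = f(v)` is the value itself. -/
theorem closed_hull (A : SortedSet M) : 𝓜.Closed (𝓜.hull A) := by
  intro σ s f v hv
  obtain ⟨a, ha, h⟩ := exists_mem_hull (.eq (headVar L s σ) (.app f fun i => (Term.var i).weak s))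
    v hv ⟨𝓜.fn f v, by simp [Str.Sat, Term.val]⟩
  obtain rfl : a = 𝓜.fn f v := by simpa [Str.Sat, Term.val] using h
  exact ha

/-- One chosen witness per formula and parameter tuple makes the generation functional, so the
labels, which are points of `A` and formulas, bound the size. -/
theorem card_hull_le (A : SortedSet M) (hA : A.card ≤ L.card) : (𝓜.hull A).card ≤ L.card := by
  have hfun : ∀ (a : SkolemLabel L A) c y y', SkolemStep 𝓜 A a c y → SkolemStep 𝓜 A a c y' →
      y = y' := by
    rintro (a | φ) c y y' h h'
    · exact Eq.trans h (Eq.symm h')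
    · obtain ⟨v, hc, _, rfl⟩ := h
      obtain ⟨v', hc', _, rfl⟩ := h'
      obtain rfl : v = v' := funext fun i =>
        eq_of_heq (Sigma.mk.inj ((hc i).symm.trans (hc' i))).2
      rfl
  refine (Cardinal.mk_le_of_injective (f := fun x : Σ s, 𝓜.hull A s =>
    (⟨⟨x.1, x.2.1⟩, x.2.2⟩ : {y // Generated (SkolemStep 𝓜 A) y})) ?_).trans
    ((card_generated_le _ hfun).trans (max_le ?_ L.aleph0_le_card))
  · rintro ⟨s, a, ha⟩ ⟨t, b, hb⟩ h
    cases congrArg Subtype.val h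
    rfl
  · rw [mk_sum, lift_id, lift_id]
    refine add_le_of_le L.aleph0_le_card hA ?_
    refine (Cardinal.mk_le_of_injective (f := fun x : Σ s : S, Σ Γ : List S, L.Formula (s :: Γ) =>
      (⟨_, x.2.2⟩ : Σ Γ, L.Formula Γ)) ?_).trans L.card_formula_le
    rintro ⟨s, Γ, φ⟩ ⟨t, Δ, ψ⟩ h
    cases h
    rfl

theorem card_rangeTup_le {Γ : List S} (p : Tup M Γ) : (rangeTup p).card ≤ ℵ₀ := by
  refine (Cardinal.mk_le_of_injective (f := fun x : Σ s, rangeTup p s =>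
    ULift.up.{u} (x.2.2.choose : ℕ)) ?_).trans (by simp)
  rintro ⟨s, a, ha⟩ ⟨t, b, hb⟩ h
  have h := Fin.ext (ULift.up.inj h)
  have h₁ := ha.choose_spec
  have h₂ := hb.choose_spec
  simp only at h
  rw [h] at h₁
  cases h₁.symm.trans h₂
  rfl

end Skolem

/-! ### Substructures, transport along partial elementary maps, Löwenheim-Skolem. -/

section Substructures

variable {L₀ L : MSLang S} {M N K : S → Type u}

theorem IsEmb.of_comp_surjective {𝓜 : L.Str M} {𝓝 : L.Str N} {𝓚 : L.Str K} {f : ∀ s, M s → N s}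
    {g : ∀ s, N s → K s} (hf : IsEmb 𝓜 𝓝 f) (hs : ∀ s, Function.Surjective (f s))
    (h : IsEmb 𝓜 𝓚 fun s a => g s (f s a)) : IsEmb 𝓝 𝓚 g where
  injective s := by
    intro x y hxy
    obtain ⟨a, rfl⟩ := hs s x
    obtain ⟨b, rfl⟩ := hs s y
    exact congrArg _ (h.injective s hxy)
  map_fn F v := by
    choose w hw using fun i => hs _ (v i)
    obtain rfl : (fun i => f _ (w i)) = v := funext hw
    rw [← hf.map_fn, h.map_fn]
  map_rel R v := by
    choose w hw using fun i => hs _ (v i)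
    obtain rfl : (fun i => f _ (w i)) = v := funext hw
    rw [← hf.map_rel, h.map_rel]

section ElemOn

variable {𝓜 : L.Str M} {𝓝 : L.Str N} {D : SortedSet M} {f : ∀ s, M s → N s}

theorem ElemOn.injOn (h : ElemOn 𝓜 𝓝 D f) {s : S} {a b : M s} (ha : a ∈ D s) (hb : b ∈ D s)
    (hab : f s a = f s b) : a = b := by
  have := (h (.eq (headVar L s [s]) ((headVar L s []).weak s))
    (consTup a (consTup b fun i => i.elim0)) (consTup_mem ha (consTup_mem hb fun i => i.elim0))).2
  simp only [map_consTup, Str.Sat, Term.val_weak, val_headVar] at this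
  exact this hab

theorem ElemOn.map_fn (h : ElemOn 𝓜 𝓝 D f) {σ : List S} {s : S} (F : L.Fn σ s) (v : Tup M σ)
    (hv : ∀ i, v i ∈ D (σ.get i)) (hF : 𝓜.fn F v ∈ D s) :
    f s (𝓜.fn F v) = 𝓝.fn F fun i => f _ (v i) := by
  have := (h (.eq (headVar L s σ) (.app F fun i => (Term.var i).weak s))
    (consTup (𝓜.fn F v) v) (consTup_mem hF hv)).1
  rw [map_consTup] at this
  simpa [Str.Sat, Term.val] using this

theorem ElemOn.map_rel (h : ElemOn 𝓜 𝓝 D f) {σ : List S} (R : L.Rel σ) (v : Tup M σ)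
    (hv : ∀ i, v i ∈ D (σ.get i)) : 𝓜.rel R v ↔ 𝓝.rel R fun i => f _ (v i) :=
  h (.rel R fun i => .var i) v hv

end ElemOn

variable {U : S → Type u} {ι : L₀.Incl L} {𝓤 : L₀.Str U}

theorem Over.IsSub.le {A B : Over ι 𝓤} (h : A.IsSub B) : A.carrier ≤ B.carrier := h.1

theorem Over.IsSub.refl (A : Over ι 𝓤) : A.IsSub A :=
  ⟨fun _ => subset_rfl, fun _ _ _ h => h, fun _ _ => rfl, fun _ _ => Iff.rfl⟩

theorem Over.IsSub.of_le {A B C : Over ι 𝓤} (h : A.IsSub C) (h' : B.IsSub C)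
    (hle : A.carrier ≤ B.carrier) : A.IsSub B :=
  ⟨hle, h'.2.of_comp h.2⟩

theorem Over.closed_carrier (A : Over ι 𝓤) : 𝓤.Closed A.carrier := by
  intro σ s F v hv
  have := A.isEmb.map_fn F fun i => ⟨v i, hv i⟩
  exact this ▸ Subtype.coe_prop _

theorem Over.mem_push {A : Over ι 𝓤} {X : SortedSet A.Univ} {s : S} (a : A.Univ s) :
    a.1 ∈ A.push X s ↔ a ∈ X s :=
  ⟨fun ⟨_, h, e⟩ => Subtype.ext e ▸ h, fun h => ⟨a, h, rfl⟩⟩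

theorem Over.push_le (A : Over ι 𝓤) (X : SortedSet A.Univ) : A.push X ≤ A.carrier := by
  rintro s _ ⟨a, _, rfl⟩
  exact a.2

theorem Over.push_mono (A : Over ι 𝓤) {X Y : SortedSet A.Univ} (h : X ≤ Y) :
    A.push X ≤ A.push Y := fun s => Set.image_mono (h s)

theorem Over.card_push_le (A : Over ι 𝓤) (X : SortedSet A.Univ) : (A.push X).card ≤ X.card := by
  refine mk_le_of_surjective (f := fun x : Σ s, X s =>
    (⟨x.1, x.2.1.1, x.2.1, x.2.2, rfl⟩ : Σ s, A.push X s)) ?_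
  rintro ⟨s, _, x, hx, rfl⟩
  exact ⟨⟨s, x, hx⟩, rfl⟩

theorem SortedSet.card_mono {A B : SortedSet U} (h : A ≤ B) : A.card ≤ B.card := by
  refine mk_le_of_injective (f := fun x : Σ s, A s => (⟨x.1, x.2.1, h _ x.2.2⟩ : Σ s, B s)) ?_
  rintro ⟨s, a, ha⟩ ⟨t, b, hb⟩ h
  cases h
  rfl

theorem SortedSet.card_image_le (f : ∀ s, U s → U s) (A : SortedSet U) :
    (A.image f).card ≤ A.card := by
  refine mk_le_of_surjective (f := fun x : Σ s, A s =>
    (⟨x.1, f _ x.2.1, x.2.1, x.2.2, rfl⟩ : Σ s, A.image f s)) ?_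
  rintro ⟨s, _, x, hx, rfl⟩
  exact ⟨⟨s, x, hx⟩, rfl⟩

theorem SortedSet.single_le {A : SortedSet U} {s : S} {a : U s} (h : a ∈ A s) :
    SortedSet.single a ≤ A := by
  rintro t b hb
  cases hb
  exact h

/-- The substructure on a closed subset. -/
def Over.sub (A : Over ι 𝓤) (X : SortedSet A.Univ) (hX : A.str.Closed X) : Over ι 𝓤 where
  carrier := A.push X
  str :=
    { fn := fun F v => ⟨(A.str.fn F fun i => ⟨(v i).1, A.push_le X _ (v i).2⟩).1, _,
        hX _ _ fun i => (Over.mem_push _).1 (v i).2, rfl⟩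
      rel := fun R v => A.str.rel R fun i => ⟨(v i).1, A.push_le X _ (v i).2⟩ }
  isEmb :=
    { injective := fun _ => Subtype.val_injective
      map_fn := fun F v => A.isEmb.map_fn F fun i => ⟨(v i).1, A.push_le X _ (v i).2⟩
      map_rel := fun R v => A.isEmb.map_rel R fun i => ⟨(v i).1, A.push_le X _ (v i).2⟩ }

theorem Over.sub_isSub (A : Over ι 𝓤) (X : SortedSet A.Univ) (hX : A.str.Closed X) :
    (A.sub X hX).IsSub A :=
  ⟨A.push_le X, fun _ => Set.inclusion_injective _, fun _ _ => rfl, fun _ _ => Iff.rfl⟩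

/-- The preimage of an element of the image. -/
noncomputable def Over.back (A : Over ι 𝓤) (f : ∀ s, U s → U s) {s : S}
    (x : A.carrier.image f s) : A.Univ s :=
  ⟨x.2.choose, x.2.choose_spec.1⟩

theorem Over.map_back (A : Over ι 𝓤) (f : ∀ s, U s → U s) {s : S} (x : A.carrier.image f s) :
    f s (A.back f x).1 = x.1 := x.2.choose_spec.2

/-- The transport of `A` along a partial elementary map. -/
noncomputable def Over.map (A : Over ι 𝓤) (f : ∀ s, U s → U s) (hf : ElemOn 𝓤 𝓤 A.carrier f) :
    Over ι 𝓤 where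
  carrier := A.carrier.image f
  str :=
    { fn := fun {_ s} F v => ⟨f s (A.str.fn F fun i => A.back f (v i)).1, _, Subtype.coe_prop _, rfl⟩
      rel := fun R v => A.str.rel R fun i => A.back f (v i) }
  isEmb :=
    { injective := fun _ => Subtype.val_injective
      map_fn := fun {_ s} F v => by
        have h := A.isEmb.map_fn F fun i => A.back f (v i)
        refine (congrArg (f s) h).trans ?_
        rw [hf.map_fn _ _ (fun i => Subtype.coe_prop _) (h ▸ Subtype.coe_prop _)]
        simp only [A.map_back f]
      map_rel := fun R v => by
        refine (A.isEmb.map_rel R fun i => A.back f (v i)).trans ?_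
        rw [hf.map_rel _ _ fun i => Subtype.coe_prop _]
        simp only [A.map_back f] }

section Map

variable (A : Over ι 𝓤) (f : ∀ s, U s → U s) (hf : ElemOn 𝓤 𝓤 A.carrier f)

/-- The isomorphism from `A` to its transport. -/
def Over.toMap (s : S) (a : A.Univ s) : (A.map f hf).Univ s := ⟨f s a.1, a.1, a.2, rfl⟩

theorem Over.toMap_surjective (s : S) : Function.Surjective (A.toMap f hf s) := by
  rintro ⟨_, a, ha, rfl⟩
  exact ⟨⟨a, ha⟩, rfl⟩

theorem Over.back_toMap {s : S} (a : A.Univ s) : A.back f (A.toMap f hf s a) = a :=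
  Subtype.ext (hf.injOn (Subtype.coe_prop _) a.2 (A.map_back f _))

theorem Over.toMap_isEmb : IsEmb A.str (A.map f hf).str (A.toMap f hf) where
  injective s a b h := Subtype.ext (hf.injOn a.2 b.2 (congrArg Subtype.val h))
  map_fn F v := Subtype.ext <| congrArg (fun w => f _ (A.str.fn F w).1)
    (funext fun i => (A.back_toMap f hf (v i)).symm)
  map_rel R v := iff_of_eq <| congrArg (A.str.rel R)
    (funext fun i => (A.back_toMap f hf (v i)).symm)

theorem Over.map_models {T : L.Theory} (h : A.str.Models T) : (A.map f hf).str.Models T :=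
  (ElemOn.models_iff ((A.toMap_isEmb f hf).elemOn_of_surjective (A.toMap_surjective f hf)) T).1 h

variable {A}

theorem Over.IsSub.map_of_fix {C : Over ι 𝓤} (h : C.IsSub A)
    (hfix : ∀ s, ∀ c ∈ C.carrier s, f s c = c) : C.IsSub (A.map f hf) := by
  refine ⟨fun s c hc => ⟨c, h.1 s hc, hfix s c hc⟩, ?_⟩
  convert (A.toMap_isEmb f hf).comp h.2 using 1
  funext s c
  exact Subtype.ext (hfix s c.1 c.2).symm

theorem Over.IsSub.map {C : Over ι 𝓤} (h : C.IsSub A) :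
    (C.map f (hf.mono h.1)).IsSub (A.map f hf) :=
  ⟨fun s => Set.image_mono (h.1 s), (C.toMap_isEmb f _).of_comp_surjective
    (C.toMap_surjective f _) ((A.toMap_isEmb f hf).comp h.2)⟩

end Map

/-- Downward Löwenheim-Skolem. -/
theorem Over.exists_small_elementary (A : Over ι 𝓤) (X : SortedSet A.Univ) (hX : X.card ≤ L.card) :
    ∃ B : Over ι 𝓤, B.carrier.card ≤ L.card ∧ A.push X ≤ B.carrier ∧
      ∃ h : B.IsSub A, ElemOn B.str A.str ⊤ fun s => Set.inclusion (h.1 s) := by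
  refine ⟨A.sub (A.str.hull X) (closed_hull X),
    (A.card_push_le _).trans (card_hull_le X hX), A.push_mono (le_hull X), A.sub_isSub _ _,
    (A.sub_isSub _ _).2.elemOn_of_witness fun φ v a ha => ?_⟩
  obtain ⟨b, hb, h⟩ := exists_mem_hull φ _ (fun i => (Over.mem_push (A := A) ⟨_, A.push_le _ _ (v i).2⟩).1 (v i).2) ⟨a, ha⟩
  exact ⟨⟨b.1, b, hb, rfl⟩, h⟩

/-- A formula with finitely many solutions gains none in an elementary extension. -/
theorem Over.acl_le_of_elementary {A B : Over ι 𝓤} (h : B.IsSub A)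
    (he : ElemOn B.str A.str ⊤ fun s => Set.inclusion (h.1 s)) {X : SortedSet A.Univ}
    (hX : A.push X ≤ B.carrier) : A.push (A.str.acl X) ≤ B.carrier := by
  rintro s _ ⟨a, ⟨Γ, φ, p, hp, ha, hfin⟩, rfl⟩
  let q : Tup B.Univ Γ := fun i => ⟨(p i).1, hX _ ((Over.mem_push _).2 (hp i))⟩
  let e : ∀ s, B.Univ s → A.Univ s := fun s => Set.inclusion (h.1 s)
  have he : ElemOn B.str A.str ⊤ e := he
  have hs : ∀ b : B.Univ s, B.str.Sat φ (consTup b q) ↔ A.str.Sat φ (consTup (e s b) p) :=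
    fun b => by rw [he φ _ fun _ => trivial, map_consTup]
  have hb : {b | B.str.Sat φ (consTup b q)}.Finite :=
    (hfin.preimage (Set.inclusion_injective (h.1 s)).injOn).subset fun b hb => (hs b).1 hb
  obtain ⟨b, -, rfl⟩ := mem_range_of_finite he _ φ q hb le_rfl a ha
  exact b.2

end Substructures

/-! ### Consequences of derivation-likeness: amalgams and relative algebraic closures. -/

section Amalgamation

variable {L₀ L : MSLang S} {U : S → Type u} {ι : L₀.Incl L} {𝓤 : L₀.Str U} {κ : Cardinal.{u}}
  {ind : SortedSet U → SortedSet U → SortedSet U → Prop} {T T' : L.Theory}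

theorem Str.Models.univPart {M : S → Type u} {𝓜 : L.Str M} (h : 𝓜.Models T) :
    𝓜.Models T.univPart := fun _ hφ => hφ.2 _ _ h

/-- A point and its image have the same type over the fixed set `C`, so one algebraic formula serves
both. -/
theorem ElemOn.mem_acl_of_map {B C : SortedSet U} {f : ∀ s, U s → U s}
    (hf : ElemOn 𝓤 𝓤 (B ⊔ C) f) (hfix : ∀ s, ∀ c ∈ C s, f s c = c) {s : S} {a : U s}
    (ha : a ∈ B s) (h : f s a ∈ 𝓤.acl C s) : a ∈ 𝓤.acl C s := by
  obtain ⟨Γ, φ, p, hp, hs, hfin⟩ := h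
  refine ⟨Γ, φ, p, hp, ?_, hfin⟩
  rw [hf φ _ (consTup_mem (.inl ha) fun i => .inr (hp i)), map_consTup]
  simpa only [hfix _ _ (hp _)] using hs

/-- Two small models of the model companion can be strongly amalgamated over a common relatively
algebraically closed substructure. -/
theorem DerivationLike.exists_amalgam (hT : DerivationLike ι T 𝓤 κ ind)
    (hT' : T'.IsModelCompanion T) (hTT' : T ⊆ T') (hmono : IndMonotone κ ind)
    (hsymm : IndSymmetric κ ind) (hfull : IndFullExistence 𝓤 κ ind)
    (hanti : IndAntiReflexive 𝓤 κ ind) {D B B₁ : Over ι 𝓤} (hBκ : B.carrier.card < κ)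
    (hB₁κ : B₁.carrier.card < κ) (hDB : D.IsSub B) (hDB₁ : D.IsSub B₁) (hB : B.str.Models T')
    (hB₁ : B₁.str.Models T') (hacl : 𝓤.acl D.carrier ⊓ B.carrier = D.carrier)
    (hacl₁ : 𝓤.acl D.carrier ⊓ B₁.carrier = D.carrier) :
    ∃ (N : S → Type u) (𝓝 : L.Str N) (e : ∀ s, B.Univ s → N s) (e₁ : ∀ s, B₁.Univ s → N s),
      ElemOn B.str 𝓝 ⊤ e ∧ ElemOn B₁.str 𝓝 ⊤ e₁ ∧
      (∀ s (x : B.Univ s) (y : B₁.Univ s), x.1 = y.1 → x.1 ∈ D.carrier s → e s x = e₁ s y) ∧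
      ∀ s (x : B.Univ s) (y : B₁.Univ s), e s x = e₁ s y → x.1 ∈ 𝓤.acl D.carrier s := by
  have hBT : B.str.Models T := fun φ hφ => hB φ (hTT' hφ)
  have hB₁T : B₁.str.Models T := fun φ hφ => hB₁ φ (hTT' hφ)
  have hDκ : D.carrier.card < κ := (SortedSet.card_mono hDB.le).trans_lt hBκ
  -- Replace `B₁` by a conjugate over `D` that is independent from `B`; its `L`-structure is
  -- transported along `h`, and it remains relatively algebraically closed over `D`.
  obtain ⟨_, ⟨h, hel, hfix, rfl⟩, hind⟩ :=
    hfull B₁.carrier B.carrier D.carrier hB₁κ hBκ hDκ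
  have hκ' : (B₁.carrier.image h).card < κ := (SortedSet.card_image_le _ _).trans_lt hB₁κ
  have hel₁ : ElemOn 𝓤 𝓤 B₁.carrier h := hel.mono le_sup_left
  have hDB' : D.IsSub (B₁.map h hel₁) := hDB₁.map_of_fix h hel₁ hfix
  have hacl' : 𝓤.acl D.carrier ⊓ (B₁.map h hel₁).carrier = D.carrier := by
    refine le_antisymm ?_ (le_inf (le_acl _ _) hDB'.le)
    rintro s _ ⟨hx, x, hxB, rfl⟩
    have : x ∈ D.carrier s := by
      rw [← hacl₁]
      exact ⟨hel.mem_acl_of_map hfix hxB hx, hxB⟩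
    rwa [hfix s x this]
  obtain ⟨⟨M, hM, hB'M, hBM⟩, -⟩ := hT (B₁.map h hel₁) B D hκ' hBκ hDκ
    (B₁.map_models h hel₁ hB₁T).univPart hBT.univPart (hDB.2.models_univPart hBT) hDB' hDB
    hacl' hacl hind
  obtain ⟨N, 𝓝, g, hN, hg⟩ := hT'.extend _ M.str hM
  refine ⟨N, 𝓝, fun s x => g s (Set.inclusion (hBM.1 s) x),
    fun s x => g s (Set.inclusion (hB'M.1 s) (B₁.toMap h hel₁ s x)),
    hT'.modelComplete _ _ _ _ hB hN _ (hg.comp hBM.2),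
    hT'.modelComplete _ _ _ _ hB₁ hN _ (hg.comp (hB'M.2.comp (B₁.toMap_isEmb h hel₁))), ?_, ?_⟩
  · intro s x y hxy hx
    refine congrArg (g s) (Subtype.ext ?_)
    exact hxy.trans (hfix s y.1 (hxy ▸ hx)).symm
  · intro s x y hxy
    have hxy : x.1 = h s y.1 := congrArg Subtype.val (hg.injective s hxy)
    have hxB : SortedSet.single x.1 ≤ B.carrier := SortedSet.single_le x.2
    have hxB₁ : SortedSet.single x.1 ≤ B₁.carrier.image h :=
      SortedSet.single_le ⟨y.1, y.2, hxy.symm⟩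
    have hxκ : (SortedSet.single x.1).card < κ := (SortedSet.card_mono hxB).trans_lt hBκ
    -- A common point of both copies is independent from itself over `D`: monotonicity, applied on
    -- each side by symmetry, shrinks both copies to that point.
    refine hanti _ _ _ hDκ (hmono _ _ _ (B₁.carrier.image h) hxκ hDκ hxκ hκ' ?_)
    rw [sup_eq_right.2 hxB₁]
    refine hsymm _ _ _ hκ' hDκ hxκ (hmono _ _ _ B.carrier hκ' hDκ hxκ hBκ ?_)
    rwa [sup_eq_right.2 hxB]

/-- The relative algebraic closure of a substructure of a model is a substructure, with a
unique compatible structure. -/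
theorem DerivationLike.exists_relative_acl (hT : DerivationLike ι T 𝓤 κ ind)
    (hfull : IndFullExistence 𝓤 κ ind) {E M : Over ι 𝓤} (hE : E.carrier.card < κ)
    (hEM : E.IsSub M) (hM : M.str.Models T) :
    ∃ C : Over ι 𝓤, C.carrier = 𝓤.acl E.carrier ⊓ M.carrier ∧ C.IsSub M ∧
      ∀ C' : Over ι 𝓤, C'.carrier = 𝓤.acl E.carrier ⊓ M.carrier → C'.str.Models T.univPart →
        E.IsSub C' → C' = C := by
  -- The only conjugate of `E` over `E` is `E` itself, so full existence yields this.
  have hind : ind E.carrier E.carrier E.carrier := by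
    obtain ⟨_, ⟨h, -, hfix, rfl⟩, hind⟩ := hfull E.carrier E.carrier E.carrier hE hE hE
    have : E.carrier.image h = E.carrier := by
      funext s
      exact (Set.image_congr (hfix s)).trans (Set.image_id' _)
    rwa [this] at hind
  have hEu := hEM.2.models_univPart hM
  have hacl : 𝓤.acl E.carrier ⊓ E.carrier = E.carrier := inf_eq_right.2 (le_acl _ _)
  -- Clause (ii) is applied to the trivial amalgam of `E` with itself over `E`; the ambient model
  -- `M` need not be small.
  obtain ⟨-, h⟩ := hT E E E hE hE hE hEu hEu hEu (.refl E) (.refl E) hacl hacl hind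
  have hcl : 𝓤.Closed (𝓤.acl E.carrier ⊓ M.carrier) := fun F v hv =>
    ⟨closed_acl _ _ F v fun i => (hv i).1, M.closed_carrier F v fun i => (hv i).2⟩
  rw [sup_idem] at h
  obtain ⟨C, hC, hCM, huniq⟩ := h M hM hEM hEM _ hcl
    (gen_le _ hcl (le_inf (le_acl _ _) hEM.le)) le_rfl
  exact ⟨C, hC, hCM, fun C' h₁ h₂ h₃ => huniq C' h₁ h₂ h₃ h₃⟩

end Amalgamation

/-! ### Comparison of the closures in `M` and in the ambient structure. -/

section Closures

variable {L₀ L : MSLang S} {U : S → Type u} {ι : L₀.Incl L} {𝓤 : L₀.Str U}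

theorem Over.coe_consTup (M : Over ι 𝓤) {s : S} {Γ : List S} (a : M.Univ s) (v : Tup M.Univ Γ) :
    (fun i => (consTup a v i).1) = consTup a.1 fun i => (v i).1 :=
  map_consTup (fun s (x : M.Univ s) => x.1) a v

theorem Over.push_gen_le_push_acl (M : Over ι 𝓤) (X : SortedSet M.Univ) :
    M.push (M.str.gen X) ≤ M.push (M.str.acl X) :=
  M.push_mono (gen_le _ (closed_acl _ _) (le_acl _ _))

/-- If sets definable in the ambient structure are definable in `M`, algebraicity descends. -/
theorem Over.acl_inf_carrier_le (M : Over ι 𝓤)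
    (h : ∀ {Γ : List S} (φ : L₀.Formula Γ), ∃ ψ : L.Formula Γ, ∀ v : Tup M.Univ Γ,
      𝓤.Sat φ (fun i => (v i).1) ↔ M.str.Sat ψ v) (X : SortedSet M.Univ) :
    𝓤.acl (M.push (M.str.gen X)) ⊓ M.carrier ≤ M.push (M.str.acl X) := by
  rintro s a ⟨⟨Γ, φ, p, hp, ha, hfin⟩, haM⟩
  choose q hq hqp using hp
  obtain rfl : (fun i => (q i).1) = p := funext hqp
  obtain ⟨ψ, hψ⟩ := h φ
  have hψ' : ∀ b : M.Univ s, M.str.Sat ψ (consTup b q) ↔ 𝓤.Sat φ (consTup b.1 fun i => (q i).1) :=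
    fun b => (hψ _).symm.trans (iff_of_eq (congrArg (𝓤.Sat φ) (M.coe_consTup b q)))
  refine ⟨⟨a, haM⟩, ?_, rfl⟩
  rw [← acl_gen]
  refine ⟨Γ, ψ, q, hq, (hψ' _).2 ha, ?_⟩
  exact (hfin.preimage Subtype.val_injective.injOn).subset fun b hb => (hψ' b).1 hb

/-- Algebraic closures of subsets of an elementary substructure are contained in it. -/
theorem Over.acl_push_le (M : Over ι 𝓤)
    (h : ElemOn (M.str.reduct ι) 𝓤 ⊤ fun _ => Subtype.val) (X : SortedSet M.Univ) :
    𝓤.acl (M.push X) ≤ M.carrier := by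
  rintro s a ⟨Γ, φ, p, hp, ha, hfin⟩
  choose q hq hqp using hp
  obtain rfl : (fun i => (q i).1) = p := funext hqp
  have hs : ∀ b : M.Univ s, (M.str.reduct ι).Sat φ (consTup b q) ↔
      𝓤.Sat φ (consTup b.1 fun i => (q i).1) :=
    fun b => (h φ _ fun _ => trivial).trans (iff_of_eq (congrArg (𝓤.Sat φ) (M.coe_consTup b q)))
  have hb : {b | (M.str.reduct ι).Sat φ (consTup b q)}.Finite :=
    (hfin.preimage Subtype.val_injective.injOn).subset fun b hb => (hs b).1 hb
  obtain ⟨b, -, rfl⟩ := mem_range_of_finite (e := fun s (x : M.Univ s) => x.1) h _ φ q hb le_rfl a ha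
  exact b.2

theorem Over.dcl_push_gen_le (M : Over ι 𝓤)
    (h : ElemOn (M.str.reduct ι) 𝓤 ⊤ fun _ => Subtype.val) (X : SortedSet M.Univ) :
    𝓤.dcl (M.push (M.str.gen X)) ≤ M.push (M.str.dcl X) := by
  rintro s a ha
  have haM := M.acl_push_le h _ _ (dcl_le_acl _ _ _ ha)
  obtain ⟨Γ, φ, p, hp, ha, huniq⟩ := ha
  choose q hq hqp using hp
  obtain rfl : (fun i => (q i).1) = p := funext hqp
  have hs : ∀ b : M.Univ s, M.str.Sat (ι.formula φ) (consTup b q) ↔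
      𝓤.Sat φ (consTup b.1 fun i => (q i).1) := fun b =>
    (Incl.sat_formula _ _ _ _).trans <|
      (h φ _ fun _ => trivial).trans (iff_of_eq (congrArg (𝓤.Sat φ) (M.coe_consTup b q)))
  exact ⟨⟨a, haM⟩, dcl_gen_le _ _ _ ⟨Γ, ι.formula φ, q, hq, (hs _).2 ha,
    fun b hb => Subtype.ext (huniq _ ((hs b).1 hb))⟩, rfl⟩

variable {κ : Cardinal.{u}} {ind : SortedSet U → SortedSet U → SortedSet U → Prop}
  {T T' : L.Theory}

/-- Amalgamate two copies of a small elementary substructure `B` containing `X` over `C`, the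
relative algebraic closure of the substructure generated by `X`. A finite set defined over `X` is
forced into the intersection of the copies. -/
theorem DerivationLike.push_acl_le (hT : DerivationLike ι T 𝓤 κ ind)
    (hT' : T'.IsModelCompanion T) (hTT' : T ⊆ T') (hmono : IndMonotone κ ind)
    (hsymm : IndSymmetric κ ind) (hfull : IndFullExistence 𝓤 κ ind)
    (hanti : IndAntiReflexive 𝓤 κ ind) (hκ : L.card < κ) {M : Over ι 𝓤} (hM : M.str.Models T')
    (hdesc : ∀ X, 𝓤.acl (M.push (M.str.gen X)) ⊓ M.carrier ≤ M.push (M.str.acl X))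
    (X : SortedSet M.Univ) (hX : X.card ≤ L.card) :
    M.push (M.str.acl X) ≤ 𝓤.acl (M.push (M.str.gen X)) := by
  have hMT : M.str.Models T := fun φ hφ => hM φ (hTT' hφ)
  obtain ⟨B, hBc, hXB, hBM, he⟩ := M.exists_small_elementary X hX
  have haclB := M.acl_le_of_elementary hBM he hXB
  have hBκ := hBc.trans_lt hκ
  have hEB : M.push (M.str.gen X) ≤ B.carrier := (M.push_gen_le_push_acl X).trans haclB
  obtain ⟨C, hC, hCM, -⟩ := hT.exists_relative_acl hfull (E := M.sub _ (closed_gen _ X))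
    ((SortedSet.card_mono hEB).trans_lt hBκ) (M.sub_isSub _ _) hMT
  have hC : C.carrier = 𝓤.acl (M.push (M.str.gen X)) ⊓ M.carrier := hC
  -- By `hdesc`, `C` lies in the algebraic closure of `X` in `M`, which every elementary
  -- substructure containing `X` contains.
  have hCB : C.carrier ≤ B.carrier := hC ▸ (hdesc X).trans haclB
  have hCacl : 𝓤.acl C.carrier ≤ 𝓤.acl (M.push (M.str.gen X)) := by
    rw [hC]
    exact (acl_mono _ inf_le_left).trans (acl_acl _ _).le
  have hacl : 𝓤.acl C.carrier ⊓ B.carrier = C.carrier := by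
    refine le_antisymm ?_ (le_inf (le_acl _ _) hCB)
    exact (inf_le_inf hCacl hBM.le).trans hC.ge
  have hXC : M.push X ≤ C.carrier := hC ▸ le_inf
    ((M.push_mono (le_gen _ X)).trans (le_acl _ _)) (M.push_le X)
  have hB : B.str.Models T' := (ElemOn.models_iff (D := ⊤) (f := fun s => Set.inclusion (hBM.1 s)) he _).2 hM
  obtain ⟨N, 𝓝, e, e₁, hel, hel₁, hagree, hdisj⟩ := hT.exists_amalgam hT' hTT' hmono hsymm hfull
    hanti hBκ hBκ (hCM.of_le hBM hCB) (hCM.of_le hBM hCB) hB hB hacl hacl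
  rintro s _ ⟨b, hb, rfl⟩
  have hbB : b.1 ∈ B.carrier s := haclB s ⟨b, hb, rfl⟩
  obtain ⟨Γ, φ, p, hp, hφ, hfin⟩ := hb
  let q : Tup B.Univ Γ := fun i => ⟨(p i).1, hXB _ ((Over.mem_push _).2 (hp i))⟩
  let j : ∀ s, B.Univ s → M.Univ s := fun s => Set.inclusion (hBM.1 s)
  have hj : ElemOn B.str M.str ⊤ j := he
  have hs : ∀ c : B.Univ s, B.str.Sat φ (consTup c q) ↔ M.str.Sat φ (consTup (j s c) p) :=
    fun c => by rw [hj φ _ fun _ => trivial, map_consTup]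
  have hqfin : {c | B.str.Sat φ (consTup c q)}.Finite :=
    (hfin.preimage (Set.inclusion_injective (hBM.1 s)).injOn).subset fun c hc => (hs c).1 hc
  have hsat := (hel φ _ fun _ => trivial).1 ((hs ⟨b.1, hbB⟩).2 hφ)
  rw [map_consTup, show (fun i => e _ (q i)) = fun i => e₁ _ (q i) from
    funext fun i => hagree _ _ _ rfl (hXC _ ((Over.mem_push _).2 (hp i)))] at hsat
  -- `e` and `e₁` agree on the parameters, so `e b` solves the formula in `N` with parameters from
  -- `e₁`; finiteness puts it in the image of `e₁`.
  obtain ⟨c, -, hc⟩ := mem_range_of_finite hel₁ _ φ q hqfin le_rfl _ hsat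
  exact hCacl _ (hdisj s ⟨b.1, hbB⟩ c hc.symm)

/-- In a strongly homogeneous structure, an element algebraic but not definable over a small set
is moved by an automorphism fixing that set. -/
theorem Str.StronglyHomogeneous.exists_aut (h𝓤 : 𝓤.StronglyHomogeneous κ) {E : SortedSet U}
    {s : S} {b : U s} (hκ : (E ⊔ SortedSet.single b).card < κ) (hb : b ∈ 𝓤.acl E s)
    (hb' : b ∉ 𝓤.dcl E s) :
    ∃ g : ∀ s, U s → U s, IsAut 𝓤 g ∧ (∀ s, ∀ a ∈ E s, g s a = a) ∧ g s b ≠ b := by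
  classical
  obtain ⟨b', hne, hconj⟩ := exists_conjugate 𝓤 hb hb'
  -- `f` sends `b` to its conjugate and fixes everything else; the cast compares elements across
  -- sorts.
  let f : ∀ t, U t → U t := fun t x => if h : ∃ h : s = t, h ▸ b = x then h.1 ▸ b' else x
  have hfb : f s b = b' := dif_pos ⟨rfl, rfl⟩
  have hfE : ∀ t, ∀ a ∈ E t, f t a = a := by
    intro t a ha
    refine dif_neg ?_
    rintro ⟨rfl, rfl⟩
    exact hb' (le_dcl _ _ _ ha)
  have hf : ElemOn 𝓤 𝓤 (E ⊔ SortedSet.single b) f := by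
    intro Γ φ v hv
    -- The same terms give `v` when evaluated at `b` and `f(v)` when evaluated at `b'`, so
    -- elementarity reduces to conjugacy over `E`.
    obtain ⟨Δ, q, r, hq, hr⟩ := exists_terms_of_mem_sup_single 𝓤 v hv
    have h₁ := hr (fun _ a => a) fun _ _ _ => rfl
    have h₂ := hr f hfE
    have := hconj (φ.subst r) q hq
    rw [hfb] at h₂
    simpa only [sat_subst, h₁, h₂] using this
  obtain ⟨g, hg, hgf⟩ := h𝓤 _ f hκ hf
  refine ⟨g, hg, fun t a ha => (hgf t a (.inl ha)).trans (hfE t a ha), ?_⟩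
  rw [hgf s b (.inr rfl), hfb]
  exact hne

theorem IsAut.image_acl {g : ∀ s, U s → U s} (hg : IsAut 𝓤 g) {E : SortedSet U}
    (hfix : ∀ s, ∀ a ∈ E s, g s a = a) : (𝓤.acl E).image g = 𝓤.acl E := by
  have hel : ElemOn 𝓤 𝓤 ⊤ g := hg.1.elemOn_of_surjective hg.2
  have hiff : ∀ (s : S) (a : U s), g s a ∈ 𝓤.acl E s ↔ a ∈ 𝓤.acl E s := by
    intro s a
    have : ∀ {Γ : List S} (φ : L₀.Formula (s :: Γ)) (p : Tup U Γ), (∀ i, p i ∈ E (Γ.get i)) →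
        (𝓤.Sat φ (consTup (g s a) p) ↔ 𝓤.Sat φ (consTup a p)) := by
      intro Γ φ p hp
      rw [hel φ (consTup a p) fun _ => trivial, map_consTup]
      simp only [hfix _ _ (hp _)]
    constructor
    · rintro ⟨Γ, φ, p, hp, h, hfin⟩
      exact ⟨Γ, φ, p, hp, (this φ p hp).1 h, hfin⟩
    · rintro ⟨Γ, φ, p, hp, h, hfin⟩
      exact ⟨Γ, φ, p, hp, (this φ p hp).2 h, hfin⟩
  funext s
  ext x
  constructor
  · rintro ⟨a, ha, rfl⟩
    exact (hiff s a).2 ha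
  · intro hx
    obtain ⟨a, rfl⟩ := hg.2 s x
    exact ⟨a, (hiff s a).1 hx, rfl⟩

/-- An ambient automorphism moving `b` over the generated substructure would let `B` and its image
be amalgamated so that the formula defining `b` has two solutions. -/
theorem DerivationLike.push_dcl_le (hT : DerivationLike ι T 𝓤 κ ind)
    (hT' : T'.IsModelCompanion T) (hTT' : T ⊆ T') (hmono : IndMonotone κ ind)
    (hsymm : IndSymmetric κ ind) (hfull : IndFullExistence 𝓤 κ ind)
    (hanti : IndAntiReflexive 𝓤 κ ind) (hκ : L.card < κ) (h𝓤 : 𝓤.StronglyHomogeneous κ)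
    {M : Over ι 𝓤} (hM : M.str.Models T')
    (hel : ElemOn (M.str.reduct ι) 𝓤 ⊤ fun _ => Subtype.val)
    (hdesc : ∀ X, 𝓤.acl (M.push (M.str.gen X)) ⊓ M.carrier ≤ M.push (M.str.acl X))
    (X : SortedSet M.Univ) (hX : X.card ≤ L.card) :
    M.push (M.str.dcl X) ≤ 𝓤.dcl (M.push (M.str.gen X)) := by
  have hMT : M.str.Models T := fun φ hφ => hM φ (hTT' hφ)
  rintro s _ ⟨b, hb, rfl⟩
  by_contra hnot
  obtain ⟨B, hBc, hXB, hBM, he⟩ := M.exists_small_elementary X hX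
  have haclB := M.acl_le_of_elementary hBM he hXB
  have hBκ := hBc.trans_lt hκ
  have hbX : b.1 ∈ M.push (M.str.acl X) s := ⟨b, dcl_le_acl _ _ _ hb, rfl⟩
  have hbB : b.1 ∈ B.carrier s := haclB s hbX
  have hEB : M.push (M.str.gen X) ≤ B.carrier := (M.push_gen_le_push_acl X).trans haclB
  have hbacl := hT.push_acl_le hT' hTT' hmono hsymm hfull hanti hκ hM hdesc X hX s hbX
  obtain ⟨g, hg, hfix, hgb⟩ := h𝓤.exists_aut ((SortedSet.card_mono
    (sup_le hEB (SortedSet.single_le hbB))).trans_lt hBκ) hbacl hnot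
  have hgel : ElemOn 𝓤 𝓤 ⊤ g := hg.1.elemOn_of_surjective hg.2
  obtain ⟨C, hC, hCM, huniq⟩ := hT.exists_relative_acl hfull (E := M.sub _ (closed_gen _ X))
    ((SortedSet.card_mono hEB).trans_lt hBκ) (M.sub_isSub _ _) hMT
  have haclM : 𝓤.acl (M.push (M.str.gen X)) ⊓ M.carrier = 𝓤.acl (M.push (M.str.gen X)) :=
    inf_eq_left.2 (M.acl_push_le hel _)
  have hC : C.carrier = 𝓤.acl (M.push (M.str.gen X)) := Eq.trans hC haclM
  have hCB : C.carrier ≤ B.carrier := by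
    rw [hC, ← haclM]
    exact (hdesc X).trans haclB
  have hCacl : 𝓤.acl C.carrier = C.carrier := by rw [hC, acl_acl]
  have hEC : (M.sub _ (closed_gen _ X)).IsSub C :=
    (M.sub_isSub _ _).of_le hCM (hC ▸ le_acl _ _)
  have hCsub : C.IsSub B := hCM.of_le hBM hCB
  have hCu : C.str.Models T.univPart := hCM.2.models_univPart hMT
  have hgB : ElemOn 𝓤 𝓤 B.carrier g := hgel.mono le_top
  -- `g` permutes `C` and fixes the generated substructure, so the transported `L`-structure is
  -- another expansion to which the uniqueness in clause (ii) applies. Hence `C` is an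
  -- `L`-substructure of both `B` and `g(B)`.
  have hCmap : C.map g (hgB.mono hCsub.1) = C := by
    refine huniq _ ?_ (C.map_models g _ hCu) (hEC.map_of_fix g _ hfix)
    refine Eq.trans (show C.carrier.image g = 𝓤.acl (M.push (M.str.gen X)) from ?_) haclM.symm
    rw [hC, hg.image_acl hfix]
  have hCsub₁ : C.IsSub (B.map g hgB) := by
    have := hCsub.map g hgB
    rwa [hCmap] at this
  have hB : B.str.Models T' := (ElemOn.models_iff (D := ⊤) (f := fun s => Set.inclusion (hBM.1 s)) he _).2 hM
  obtain ⟨N, 𝓝, e, e₁, hel, hel₁, hagree, -⟩ := hT.exists_amalgam hT' hTT' hmono hsymm hfull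
    hanti hBκ ((SortedSet.card_image_le g B.carrier).trans_lt hBκ) hCsub hCsub₁ hB
    (B.map_models g hgB hB) (hCacl.symm ▸ inf_eq_left.2 hCB)
    (hCacl.symm ▸ inf_eq_left.2 hCsub₁.le)
  obtain ⟨Γ, φ, p, hp, hφ, hφb⟩ := hb
  let q : Tup B.Univ Γ := fun i => ⟨(p i).1, hXB _ ((Over.mem_push _).2 (hp i))⟩
  let j : ∀ s, B.Univ s → M.Univ s := fun s => Set.inclusion (hBM.1 s)
  have hj : ElemOn B.str M.str ⊤ j := he
  have hs : ∀ c : B.Univ s, B.str.Sat φ (consTup c q) ↔ M.str.Sat φ (consTup (j s c) p) :=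
    fun c => by rw [hj φ _ fun _ => trivial, map_consTup]
  have hqb : ∀ c : B.Univ s, B.str.Sat φ (consTup c q) → c = ⟨b.1, hbB⟩ := fun c hc =>
    Subtype.ext (congrArg (fun x : M.Univ s => x.1) (hφb _ ((hs c).1 hc)))
  let e₂ : ∀ s, B.Univ s → N s := fun s a => e₁ s (B.toMap g hgB s a)
  have hel₂ : ElemOn B.str 𝓝 ⊤ e₂ := fun φ v _ =>
    ((B.toMap_isEmb g hgB).elemOn_of_surjective (B.toMap_surjective g hgB) φ v
      fun _ => trivial).trans (hel₁ φ _ fun _ => trivial)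
  have hsat := (hel₂ φ _ fun _ => trivial).1 ((hs ⟨b.1, hbB⟩).2 hφ)
  have he₂q : (fun i => e₂ _ (q i)) = fun i => e _ (q i) := funext fun i => by
    have hpE : (p i).1 ∈ M.push (M.str.gen X) (Γ.get i) :=
      (Over.mem_push _).2 (le_gen _ X _ (hp i))
    exact (hagree _ _ _ (hfix _ _ hpE).symm (hC ▸ le_acl _ _ _ hpE)).symm
  rw [map_consTup, he₂q] at hsat
  obtain ⟨c, hc, hce⟩ := mem_range_of_finite hel _ φ q
    ((Set.finite_singleton _).subset hqb) le_rfl _ hsat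
  have hbC : b.1 ∈ C.carrier s := hC ▸ hbacl
  have hgbC : g s b.1 ∈ C.carrier s := by
    rw [hC, ← hg.image_acl hfix]
    exact ⟨_, hbacl, rfl⟩
  -- Both embeddings agree at `g(b) ∈ C`. As an element of `g(B)` it solves the formula in `N`,
  -- where the only solution is `e b`; injectivity of `e` then gives `g(b) = b`.
  have h₁ := hagree s ⟨g s b.1, hCB s hgbC⟩ (B.toMap g hgB s ⟨b.1, hbB⟩) rfl hgbC
  have h₂ := hel.injOn trivial trivial (h₁.trans hce.symm)
  exact hgb ((congrArg Subtype.val (h₂.trans (hqb c hc))))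

end Closures

end MSLang

/-! ### The theorem. -/

open MSLang in
theorem mainTheorem8 {S : Type u} {L₀ L : MSLang S} (ι : L₀.Incl L)
    (T₀ : L₀.Theory) (T Tplus Tcompl : L.Theory)
    (hT₀_closed : T₀.DeductivelyClosed) (hT_closed : T.DeductivelyClosed)
    (hTplus_closed : Tplus.DeductivelyClosed) (hTcompl_closed : Tcompl.DeductivelyClosed)
    (hT₀_complete : T₀.Complete) (hT₀_modelComplete : T₀.ModelComplete)
    {U₀ : S → Type u} (𝓤₀ : L₀.Str U₀) (κ₀ : Cardinal.{u})
    (h𝓤₀ : MSLang.IsMonster T₀ 𝓤₀ κ₀) (hκ₀ : L.card < κ₀)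
    (ind : SortedSet U₀ → SortedSet U₀ → SortedSet U₀ → Prop)
    (hinv : MSLang.IndInvariant 𝓤₀ κ₀ ind)
    (hT₀T : ι.theory T₀.univPart ⊆ T)
    (hT : MSLang.DerivationLike ι T 𝓤₀ κ₀ ind)
    (hTplus : Tplus.IsModelCompanion T) (hTTplus : T ⊆ Tplus)
    (hTcompl_complete : Tcompl.Complete) (hTcompl : Tplus ⊆ Tcompl)
    (Uplus : MSLang.Over ι 𝓤₀) (κplus : Cardinal.{u})
    (hUplus : MSLang.IsMonster Tcompl Uplus.str κplus)
    (hQE : ¬ ι.theory T₀ ⊆ Tplus → T₀.QE)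
    (hmono : MSLang.IndMonotone κ₀ ind)
    (hsymm : MSLang.IndSymmetric κ₀ ind)
    (hfull : MSLang.IndFullExistence 𝓤₀ κ₀ ind)
    (hanti : MSLang.IndAntiReflexive 𝓤₀ κ₀ ind) :
    (∀ A : SortedSet Uplus.Univ,
      Uplus.push (Uplus.str.acl A) =
        𝓤₀.acl (Uplus.push (Uplus.str.gen A)) ⊓ Uplus.carrier) ∧
    (ι.theory T₀ ⊆ Tplus → ∀ A : SortedSet Uplus.Univ,
      Uplus.push (Uplus.str.dcl A) = 𝓤₀.dcl (Uplus.push (Uplus.str.gen A))) := by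
  have hT' : Uplus.str.Models Tplus := fun φ hφ => hUplus.models φ (hTcompl hφ)
  have hel : ι.theory T₀ ⊆ Tplus →
      ElemOn (Uplus.str.reduct ι) 𝓤₀ ⊤ fun _ => Subtype.val := fun h =>
    hT₀_modelComplete _ _ _ _
      (fun φ hφ => (Incl.sat_formula ι _ _ _).1 (hT' _ (h ⟨φ, hφ, rfl⟩))) h𝓤₀.models _ Uplus.isEmb
  have hdef : ∀ {Γ : List S} (φ : L₀.Formula Γ), ∃ ψ : L.Formula Γ, ∀ v : Tup Uplus.Univ Γ,
      𝓤₀.Sat φ (fun i => (v i).1) ↔ Uplus.str.Sat ψ v := by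
    intro Γ φ
    by_cases h : ι.theory T₀ ⊆ Tplus
    · exact ⟨ι.formula φ, fun v =>
        (hel h φ v fun _ => trivial).symm.trans (Incl.sat_formula ι _ _ _).symm⟩
    · obtain ⟨ψ, hψ, heq⟩ := hQE h Γ φ
      exact ⟨ι.formula ψ, fun v => (heq _ _ h𝓤₀.models _).trans <|
        (Uplus.isEmb.sat_of_isQF hψ v).symm.trans (Incl.sat_formula ι _ _ _).symm⟩
  have hdesc := Uplus.acl_inf_carrier_le hdef
  refine ⟨fun A => le_antisymm (le_inf ?_ (Uplus.push_le _)) (hdesc A), fun h A =>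
    le_antisymm ?_ (Uplus.dcl_push_gen_le (hel h) A)⟩
  -- `A` may be large, so it is replaced by the finite set of parameters of `φ`, to which
  -- Löwenheim-Skolem applies.
  · rintro s _ ⟨a, ⟨Γ, φ, p, hp, ha⟩, rfl⟩
    refine acl_mono _ (Uplus.push_mono (gen_mono _ (rangeTup_le hp))) _ ?_
    exact hT.push_acl_le hTplus hTTplus hmono hsymm hfull hanti hκ₀ hT' hdesc (rangeTup p)
      ((card_rangeTup_le p).trans L.aleph0_le_card) s
      ⟨a, ⟨Γ, φ, p, mem_rangeTup p, ha⟩, rfl⟩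
  · rintro s _ ⟨a, ⟨Γ, φ, p, hp, ha⟩, rfl⟩
    refine dcl_mono _ (Uplus.push_mono (gen_mono _ (rangeTup_le hp))) _ ?_
    exact hT.push_dcl_le hTplus hTTplus hmono hsymm hfull hanti hκ₀ h𝓤₀.homogeneous hT' (hel h)
      hdesc (rangeTup p) ((card_rangeTup_le p).trans L.aleph0_le_card) s
      ⟨a, ⟨Γ, φ, p, mem_rangeTup p, ha⟩, rfl⟩
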